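/- **Theorem 2.2.** For integers $n,p\ge 1$ and reals $\sigma,\Delta>0$, consider the Gaussian mixture model $$Y_i=\theta\,\eta_i+\sigma\xi_i,\qquad i=1,\dots,n,$$ where $\theta\in\mathbb R^p$ and $\eta\in\{-1,1\}^n$ are unknown and $\xi_1,\dots,\xi_n$ are independent standard Gaussian vectors in $\mathbb R^p$. Let $\mathbf E_{(\theta,\eta)}$ denote the expectation with respect to the distribution of $Y=(Y_1,\dots,Y_n)$, let $\Omega_\Delta=\{\theta\in\mathbb R^p:\|\theta\|\ge\Delta\}\times\{-1,1\}^n$, where $\|\cdot\|$ is the Euclidean norm, and let $$r(\tilde\eta,\eta)=\min_{\nu\in\{-1,1\}}\sum_{j=1}^n|\tilde\eta_j-\nu\eta_j|.$$ The minimax risk is $$\Psi_\Delta=\inf_{\tilde\eta}\ \sup_{(\theta,\eta)\in\Omega_\Delta}\frac1n\,\mathbf E_{(\theta,\eta)}\,r(\tilde\eta,\eta),$$ where the infimum is over all measurable functions $\tilde\eta=\tilde\eta(Y)$ with values in $\{-1,1\}^n$. Put $$\mathbf r_n=\frac{\Delta^2/\sigma^2}{\sqrt{\Delta^2/\sigma^2+p/n}},\qquad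 \Phi^{\mathsf c}(t)=\mathbf P(z>t)\quad\text{for } z\sim\mathcal N(0,1).$$ Then there exist an absolute constant $c>0$, a real sequence $(\epsilon_n)$ with $\epsilon_n\to0$, and an integer $n_0$ such that, for all $n\ge n_0$, all $p\ge1$ and all $\sigma,\Delta>0$, $$\Psi_\Delta\ \ge\ c\,\Phi^{\mathsf c}\bigl(\mathbf r_n(1+\epsilon_n)\bigr).$$ In particular $c$, $(\epsilon_n)$ and $n_0$ do not depend on $p,\sigma,\Delta$, all three of which may vary arbitrarily with $n$. -/

import Mathlib

open Filter Topology MeasureTheory ProbabilityTheory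

namespace GaussianMixture

/-- Label vectors `η ∈ {-1, 1}ⁿ`; `ℤˣ` is the two-element type `{1, -1}`. -/
abbrev Labels (n : ℕ) : Type := Fin n → ℤˣ

/-- Observations `Y = (Y₁, …, Yₙ)`, each `Yᵢ` a vector of Euclidean `ℝᵖ`. -/
abbrev Observations (n p : ℕ) : Type := Fin n → EuclideanSpace ℝ (Fin p)

/-- The label `ηᵢ` as a real number. -/
def label {n : ℕ} (η : Labels n) (i : Fin n) : ℝ := ((η i : ℤ) : ℝ)

/-- The distribution `P_(θ,η)` of `Y`, where `Yᵢ = ηᵢ θ + σ ξᵢ` and `ξ₁, …, ξₙ` are independent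
standard Gaussian vectors of `ℝᵖ`. -/
noncomputable def law (n p : ℕ) (σ : ℝ) (θ : EuclideanSpace ℝ (Fin p)) (η : Labels n) :
    Measure (Observations n p) :=
  (Measure.pi fun _ : Fin n => stdGaussian (EuclideanSpace ℝ (Fin p))).map
    fun ξ i => label η i • θ + σ • ξ i

/-- The parameter set `Ω_Δ = {θ : ‖θ‖ ≥ Δ} × {-1, 1}ⁿ`. -/
def parameterSet (n p : ℕ) (Δ : ℝ) : Set (EuclideanSpace ℝ (Fin p) × Labels n) :=
  {θ | Δ ≤ ‖θ‖} ×ˢ Set.univ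

/-- The Hamming distance `|η₁ - η₂| = ∑ⱼ |η₁ⱼ - η₂ⱼ|`. -/
noncomputable def hamming {n : ℕ} (η₁ η₂ : Labels n) : ℝ :=
  ∑ j, |label η₁ j - label η₂ j|

/-- The loss `r(η₁, η₂)`, the minimum over `ν ∈ {-1, 1}` of `|η₁ - ν η₂|`. -/
noncomputable def loss {n : ℕ} (η₁ η₂ : Labels n) : ℝ :=
  min (hamming η₁ η₂) (hamming η₁ (-η₂))

/-- Estimators of the labels: all measurable functions of the observations with values in
`{-1, 1}ⁿ`. -/
def Estimator (n p : ℕ) : Type :=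
  {f : Observations n p → Labels n // Measurable f}

/-- The normalized expected loss `(1/n) E_(θ,η) r(η̂, η)`. The loss is nonnegative; the expectation
is taken in `[0, ∞]`, so that the suprema and infima below are those of a complete lattice. -/
noncomputable def risk {n p : ℕ} (σ : ℝ) (est : Estimator n p)
    (θ : EuclideanSpace ℝ (Fin p)) (η : Labels n) : ENNReal :=
  (n : ENNReal)⁻¹ * ∫⁻ Y, ENNReal.ofReal (loss (est.1 Y) η) ∂(law n p σ θ η)

/-- The minimax risk `Ψ_Δ`. -/
noncomputable def minimaxRisk (n p : ℕ) (σ Δ : ℝ) : ENNReal :=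
  ⨅ est : Estimator n p, ⨆ x ∈ parameterSet n p Δ, risk σ est x.1 x.2

/-- The signal-to-noise ratio `r_n = (Δ²/σ²) / √(Δ²/σ² + p/n)`. -/
noncomputable def snr (n p : ℕ) (σ Δ : ℝ) : ℝ :=
  (Δ ^ 2 / σ ^ 2) / √(Δ ^ 2 / σ ^ 2 + (p : ℝ) / (n : ℝ))

/-- The complementary distribution function `Φᶜ(t) = P(z > t)` of a standard Gaussian `z`. -/
noncomputable def gaussianTail (t : ℝ) : ℝ :=
  (gaussianReal 0 1).real (Set.Ioi t)

end GaussianMixture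

/-!
The minimax risk is bounded from below by Bayes risks. The labels get the uniform prior and `θ` a
Gaussian prior `N(θ₀, α² I)`.

The loss divided by `n` is at least the proportion of pairs `(i, j)` whose relative sign is
estimated wrongly (`sum_ite_le_loss`). For a fixed pair, averaging over the `i`-th label turns
the probability of a wrong relative sign into the sum of the two errors of a test between two label
vectors which differ at `i` only. By conjugacy of the Gaussian prior, given the
other observations `Yᵢ` is Gaussian with mean `ηᵢ` times the conditional mean of `θ` and standard
deviation at least `σ` (`lintegral_law_eq_lintegral_posteriorMean`), so that these errors add up to
at least `2 Φᶜ(‖conditional mean‖ / σ)` on average. Since `x ↦ Φᶜ(√x)` is convex, Jensen's inequality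
replaces the norm by its root mean square, which is explicit
(`two_mul_gaussianTail_le_lintegral_law`). The result is a lower bound valid for all `n ≥ 2`, up to
the prior mass of the ball `{‖θ‖ < Δ}` (`gaussianTail_le_two_mul_iSup_risk`).

Two priors are used, with `ε = n ^ (-1/8)`. For `α = 0` and `‖θ₀‖ = Δ` the bound is `Φᶜ(Δ / σ)`; this
is at least `Φᶜ(2)` if `Δ / σ ≤ 2`, and it suffices if `p ≤ ε n Δ² / σ²`, because then
`Δ / σ ≤ r_n (1 + ε)`. Otherwise `θ₀ = 0` and `α² = Δ² (1 + ε) / p` give `Φᶜ(t)` with `t ≤ r_n (1 + ε)`. By a Chernoff bound the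
prior mass of the ball is then at most `exp (-p ε² / 12)`. Since `p > ε n Δ² / σ²` and `Δ / σ > 2`,
this is at most a quarter of `Φᶜ(r_n (1 + ε))`, which is at least `C exp (-4 p / (ε² n))`.
-/

namespace GaussianMixture

/-! ### Tails of the one-dimensional Gaussian distribution -/

lemma gaussianTail_nonneg (t : ℝ) : 0 ≤ gaussianTail t := measureReal_nonneg

lemma gaussianTail_le_one (t : ℝ) : gaussianTail t ≤ 1 := measureReal_le_one

lemma gaussianTail_antitone : Antitone gaussianTail := fun _ _ h =>
  measureReal_mono (Set.Ioi_subset_Ioi h)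

lemma gaussianTail_eq_integral (t : ℝ) :
    gaussianTail t = ∫ x in Set.Ioi t, gaussianPDFReal 0 1 x := by
  rw [gaussianTail, measureReal_def, gaussianReal_apply_eq_integral 0 one_ne_zero,
    ENNReal.toReal_ofReal (integral_nonneg fun x => gaussianPDFReal_nonneg 0 1 x)]

lemma ofReal_gaussianTail (t : ℝ) :
    ENNReal.ofReal (gaussianTail t) = gaussianReal 0 1 (Set.Ioi t) := by
  rw [gaussianTail, ofReal_measureReal]

lemma gaussianPDFReal_le_of_sq_le {a b x y : ℝ} (h : (y - b) ^ 2 ≤ (x - a) ^ 2) :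
    gaussianPDFReal a 1 x ≤ gaussianPDFReal b 1 y := by
  simp only [gaussianPDFReal]
  gcongr

lemma gaussianTail_sub_gaussianTail {a b : ℝ} (h : a ≤ b) :
    gaussianTail a - gaussianTail b = ∫ x in Set.Ioc a b, gaussianPDFReal 0 1 x := by
  rw [gaussianTail_eq_integral, gaussianTail_eq_integral, ← Set.Ioc_union_Ioi_eq_Ioi h,
    setIntegral_union (Set.Ioc_disjoint_Ioi le_rfl) measurableSet_Ioi
      (integrable_gaussianPDFReal 0 1).integrableOn (integrable_gaussianPDFReal 0 1).integrableOn]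
  ring

/-- The tangent-line inequality for the function `t ↦ Φᶜ(√t)`, which is convex. -/
lemma le_gaussianTail_add_sq_sub_sq {t₀ t : ℝ} (h₀ : 0 < t₀) (ht : 0 ≤ t) :
    gaussianTail t₀ ≤
      gaussianTail t + gaussianPDFReal 0 1 t₀ / (2 * t₀) * (t ^ 2 - t₀ ^ 2) := by
  have hφ := gaussianPDFReal_nonneg 0 1 t₀
  have key : gaussianTail t₀ ≤ gaussianTail t + gaussianPDFReal 0 1 t₀ * (t - t₀) := by
    rcases le_total t₀ t with h | h
    · have h1 := gaussianTail_sub_gaussianTail h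
      have h2 : ∫ x in Set.Ioc t₀ t, gaussianPDFReal 0 1 x ≤
          ∫ x in Set.Ioc t₀ t, gaussianPDFReal 0 1 t₀ := by
        refine setIntegral_mono_on (integrable_gaussianPDFReal 0 1).integrableOn (by simp)
          measurableSet_Ioc fun x hx => gaussianPDFReal_le_of_sq_le ?_
        nlinarith [hx.1]
      simp [h] at h2
      linarith
    · have h1 := gaussianTail_sub_gaussianTail h
      have h2 : ∫ x in Set.Ioc t t₀, gaussianPDFReal 0 1 t₀ ≤
          ∫ x in Set.Ioc t t₀, gaussianPDFReal 0 1 x := by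
        refine setIntegral_mono_on (by simp) (integrable_gaussianPDFReal 0 1).integrableOn
          measurableSet_Ioc fun x hx => gaussianPDFReal_le_of_sq_le ?_
        nlinarith [hx.1, hx.2]
      simp [h] at h2
      linarith
  have h3 : gaussianPDFReal 0 1 t₀ / (2 * t₀) * (t ^ 2 - t₀ ^ 2) -
      gaussianPDFReal 0 1 t₀ * (t - t₀) = gaussianPDFReal 0 1 t₀ / (2 * t₀) * (t - t₀) ^ 2 := by
    field_simp
    ring
  have h4 : 0 ≤ gaussianPDFReal 0 1 t₀ / (2 * t₀) * (t - t₀) ^ 2 := by positivity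
  linarith

lemma exp_neg_sq_le_gaussianTail {t : ℝ} (ht : 0 ≤ t) :
    (√(2 * Real.pi))⁻¹ * Real.exp (-1) * Real.exp (-t ^ 2) ≤ gaussianTail t := by
  have h1 := gaussianTail_sub_gaussianTail (show t ≤ t + 1 by linarith)
  have h2 : ∫ x in Set.Ioc t (t + 1), gaussianPDFReal 0 1 (t + 1) ≤
      ∫ x in Set.Ioc t (t + 1), gaussianPDFReal 0 1 x := by
    refine setIntegral_mono_on (by simp) (integrable_gaussianPDFReal 0 1).integrableOn
      measurableSet_Ioc fun x hx => gaussianPDFReal_le_of_sq_le ?_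
    nlinarith [hx.1, hx.2]
  have h3 : (√(2 * Real.pi))⁻¹ * Real.exp (-1) * Real.exp (-t ^ 2) ≤
      gaussianPDFReal 0 1 (t + 1) := by
    rw [gaussianPDFReal, mul_assoc, ← Real.exp_add]
    simp only [NNReal.coe_one, mul_one, sub_zero]
    gcongr
    nlinarith [sq_nonneg (t - 1)]
  simp at h2
  linarith [gaussianTail_nonneg (t + 1)]

/-- Lower bound for the sum of the two errors of a test `B` between the hypotheses `N(r, 1)` and
`N(-r, 1)`. -/
lemma two_mul_gaussianTail_le_gaussianReal {r : ℝ} (hr : 0 ≤ r) {B : Set ℝ}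
    (hB : MeasurableSet B) :
    ENNReal.ofReal (2 * gaussianTail r) ≤
      gaussianReal 0 1 {z | r + z ∈ B} + gaussianReal 0 1 {z | -r + z ∈ Bᶜ} := by
  have hmap : ∀ a : ℝ, ∀ S : Set ℝ, MeasurableSet S →
      gaussianReal 0 1 {z | a + z ∈ S} = gaussianReal a 1 S := by
    intro a S hS
    have := gaussianReal_map_const_add (μ := 0) (v := 1) a
    rw [zero_add] at this
    rw [← this, Measure.map_apply (by fun_prop) hS]
    rfl
  -- Which of the two densities is larger is decided by the sign.
  have hpos : ∀ S : Set ℝ, MeasurableSet S → S ⊆ Set.Ioi 0 →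
      gaussianReal (-r) 1 S ≤ gaussianReal r 1 S := by
    intro S hS h
    rw [gaussianReal_apply _ one_ne_zero, gaussianReal_apply _ one_ne_zero]
    refine setLIntegral_mono' hS fun x hx => ENNReal.ofReal_le_ofReal
      (gaussianPDFReal_le_of_sq_le ?_)
    have : 0 < x := h hx
    nlinarith
  have hneg : ∀ S : Set ℝ, MeasurableSet S → S ⊆ Set.Iio 0 →
      gaussianReal r 1 S ≤ gaussianReal (-r) 1 S := by
    intro S hS h
    rw [gaussianReal_apply _ one_ne_zero, gaussianReal_apply _ one_ne_zero]
    refine setLIntegral_mono' hS fun x hx => ENNReal.ofReal_le_ofReal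
      (gaussianPDFReal_le_of_sq_le ?_)
    have : x < 0 := h hx
    nlinarith
  have e1 : gaussianReal (-r) 1 (Set.Ioi 0) = ENNReal.ofReal (gaussianTail r) := by
    rw [← hmap _ _ measurableSet_Ioi, ofReal_gaussianTail]
    congr 1
    ext z
    simp
  have e2 : gaussianReal r 1 (Set.Iio 0) = ENNReal.ofReal (gaussianTail r) := by
    have h0 := gaussianReal_map_neg (μ := -r) (v := 1)
    rw [neg_neg] at h0
    rw [← e1, ← h0, Measure.map_apply (by fun_prop) measurableSet_Iio]
    congr 1
    ext z
    simp
  rw [hmap _ _ hB, hmap _ _ hB.compl, two_mul,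
    ENNReal.ofReal_add (gaussianTail_nonneg r) (gaussianTail_nonneg r)]
  nth_rewrite 1 [← e2]
  rw [← e1]
  have i1 : gaussianReal r 1 (B ∩ Set.Iio 0) + gaussianReal r 1 (B ∩ Set.Ioi 0) ≤
      gaussianReal r 1 B := by
    rw [← measure_union (Set.disjoint_left.2 fun x h h' =>
        lt_asymm (Set.mem_Iio.1 h.2) (Set.mem_Ioi.1 h'.2))
      (hB.inter measurableSet_Ioi)]
    exact measure_mono (by grind)
  have i2 : gaussianReal (-r) 1 (Bᶜ ∩ Set.Iio 0) + gaussianReal (-r) 1 (Bᶜ ∩ Set.Ioi 0) ≤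
      gaussianReal (-r) 1 Bᶜ := by
    rw [← measure_union (Set.disjoint_left.2 fun x h h' =>
        lt_asymm (Set.mem_Iio.1 h.2) (Set.mem_Ioi.1 h'.2))
      (hB.compl.inter measurableSet_Ioi)]
    exact measure_mono (by grind)
  have j1 := hpos (B ∩ Set.Ioi 0) (hB.inter measurableSet_Ioi) Set.inter_subset_right
  have j2 := hneg (Bᶜ ∩ Set.Iio 0) (hB.compl.inter measurableSet_Iio) Set.inter_subset_right
  have k1 : gaussianReal r 1 (Set.Iio 0) ≤
      gaussianReal r 1 (B ∩ Set.Iio 0) + gaussianReal r 1 (Bᶜ ∩ Set.Iio 0) :=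
    (measure_mono (by grind)).trans (measure_union_le _ _)
  have k2 : gaussianReal (-r) 1 (Set.Ioi 0) ≤
      gaussianReal (-r) 1 (B ∩ Set.Ioi 0) + gaussianReal (-r) 1 (Bᶜ ∩ Set.Ioi 0) :=
    (measure_mono (by grind)).trans (measure_union_le _ _)
  calc gaussianReal r 1 (Set.Iio 0) + gaussianReal (-r) 1 (Set.Ioi 0)
      ≤ (gaussianReal r 1 (B ∩ Set.Iio 0) + gaussianReal (-r) 1 (Bᶜ ∩ Set.Iio 0)) +
        (gaussianReal r 1 (B ∩ Set.Ioi 0) + gaussianReal (-r) 1 (Bᶜ ∩ Set.Ioi 0)) := by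
        gcongr
        · exact k1.trans (by gcongr)
        · exact k2.trans (by gcongr)
    _ = (gaussianReal r 1 (B ∩ Set.Iio 0) + gaussianReal r 1 (B ∩ Set.Ioi 0)) +
        (gaussianReal (-r) 1 (Bᶜ ∩ Set.Iio 0) + gaussianReal (-r) 1 (Bᶜ ∩ Set.Ioi 0)) := by
        ring
    _ ≤ _ := by gcongr

/-! ### Standard Gaussian vectors: testing and independence -/

section StdGaussian

open scoped RealInnerProductSpace

variable {E : Type*} [NormedAddCommGroup E] [InnerProductSpace ℝ E] [FiniteDimensional ℝ E]
  [MeasurableSpace E] [BorelSpace E]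

lemma cov_inner_stdGaussian (x y : E) :
    cov[fun g => ⟪x, g⟫, fun g => ⟪y, g⟫; stdGaussian E] = ⟪x, y⟫ := by
  rw [← covarianceBilin_apply_eq_cov IsGaussian.memLp_two_id, covarianceBilin_stdGaussian]
  rfl

lemma map_inner_stdGaussian {e : E} (he : ‖e‖ = 1) :
    (stdGaussian E).map (fun g => ⟪e, g⟫) = gaussianReal 0 1 := by
  have h : HasGaussianLaw (fun g => ⟪e, g⟫) (stdGaussian E) :=
    IsGaussian.hasGaussianLaw_id.map_fun (innerSL ℝ e)
  have h1 : ∫ g, ⟪e, g⟫ ∂stdGaussian E = 0 := integral_strongDual_stdGaussian (innerSL ℝ e)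
  have h2 : Var[fun g => ⟪e, g⟫; stdGaussian E] = ‖innerSL ℝ e‖ ^ 2 :=
    variance_dual_stdGaussian (innerSL ℝ e)
  rw [h.map_eq_gaussianReal, h1, h2, innerSL_apply_norm, he]
  simp

/-- The components of a standard Gaussian vector along a line and orthogonally to it are
independent. -/
lemma indepFun_inner_sub_stdGaussian {e : E} (he : ‖e‖ = 1) :
    IndepFun (fun g => g - ⟪e, g⟫ • e) (fun g => ⟪e, g⟫) (stdGaussian E) := by
  have h : HasGaussianLaw (fun g : E => (g - ⟪e, g⟫ • e, ⟪e, g⟫)) (stdGaussian E) :=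
    IsGaussian.hasGaussianLaw_id.map_fun
      ((ContinuousLinearMap.id ℝ E - (innerSL ℝ e).smulRight e).prod (innerSL ℝ e))
  refine h.indepFun_of_covariance_inner fun x y => ?_
  have e1 : (fun g : E => ⟪x, g - ⟪e, g⟫ • e⟫) = fun g => ⟪x - ⟪x, e⟫ • e, g⟫ := by
    ext g
    simp only [inner_sub_left, inner_sub_right, inner_smul_left, inner_smul_right]
    simp [mul_comm]
  have e2 : (fun g : E => ⟪y, ⟪e, g⟫⟫) = fun g => ⟪y • e, g⟫ := by
    ext g
    simp [inner_smul_left, mul_comm]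
  rw [e1, e2, cov_inner_stdGaussian]
  simp [inner_sub_left, inner_smul_left, inner_smul_right, he]

/-- Lower bound for the sum of the two errors of a test `B` between the hypotheses `N(u, τ²)` and
`N(-u, τ²)` on a Euclidean space. -/
lemma two_mul_gaussianTail_le_stdGaussian (u : E) {τ : ℝ} (hτ : 0 < τ) {B : Set E}
    (hB : MeasurableSet B) :
    ENNReal.ofReal (2 * gaussianTail (‖u‖ / τ)) ≤
      stdGaussian E {g | u + τ • g ∈ B} + stdGaussian E {g | -u + τ • g ∈ Bᶜ} := by
  rcases eq_or_ne u 0 with rfl | hu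
  · have h := two_mul_gaussianTail_le_gaussianReal le_rfl MeasurableSet.univ
    have hm : MeasurableSet {g : E | τ • g ∈ B} := hB.preimage (by fun_prop)
    have h1 := measure_add_measure_compl (μ := stdGaussian E) hm
    simp only [norm_zero, zero_div, zero_add, neg_zero]
    refine h.trans (le_of_eq ?_)
    simp only [measure_univ] at h1
    simpa using! h1.symm
  set e : E := ‖u‖⁻¹ • u with he_def
  have hu' : ‖u‖ ≠ 0 := norm_ne_zero_iff.2 hu
  have he : ‖e‖ = 1 := by simp [he_def, norm_smul, hu']
  have hue : u = ‖u‖ • e := by simp [he_def, smul_smul, hu']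
  have hind := indepFun_inner_sub_stdGaussian he
  rw [indepFun_iff_map_prod_eq_prod_map_map (by fun_prop) (by fun_prop),
    map_inner_stdGaussian he] at hind
  set ν := (stdGaussian E).map (fun g => g - ⟪e, g⟫ • e) with hν
  have : IsProbabilityMeasure ν := Measure.isProbabilityMeasure_map (by fun_prop)
  have hsplit : ∀ a : ℝ, ∀ S : Set E, MeasurableSet S →
      stdGaussian E {g | (τ * a) • e + τ • g ∈ S} =
        ∫⁻ h, gaussianReal 0 1 {z | a + z ∈ {x : ℝ | τ • (h + x • e) ∈ S}} ∂ν := by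
    intro a S hS
    have hS' : MeasurableSet {q : E × ℝ | τ • (q.1 + (a + q.2) • e) ∈ S} :=
      hS.preimage (by fun_prop)
    have := congrArg (fun μ => μ {q : E × ℝ | τ • (q.1 + (a + q.2) • e) ∈ S}) hind
    rw [Measure.map_apply (by fun_prop) hS', Measure.prod_apply hS'] at this
    refine Eq.trans ?_ this
    congr 1
    ext g
    simp only [Set.mem_ofPred_eq, Set.preimage_ofPred_eq]
    congr! 1
    module
  have hr : ‖u‖ = τ * (‖u‖ / τ) := by field_simp
  have hl : {g : E | u + τ • g ∈ B} = {g | (τ * (‖u‖ / τ)) • e + τ • g ∈ B} := by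
    rw [← hr, ← hue]
  have hl' : {g : E | -u + τ • g ∈ Bᶜ} = {g | (τ * (-(‖u‖ / τ))) • e + τ • g ∈ Bᶜ} := by
    rw [mul_neg, ← hr, neg_smul, ← hue]
  rw [hl, hl', hsplit _ _ hB, hsplit _ _ hB.compl, ← lintegral_add_left]
  · calc ENNReal.ofReal (2 * gaussianTail (‖u‖ / τ))
        = ∫⁻ h, ENNReal.ofReal (2 * gaussianTail (‖u‖ / τ)) ∂ν := by simp
      _ ≤ _ := by
        refine lintegral_mono fun h => ?_
        exact two_mul_gaussianTail_le_gaussianReal (by positivity)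
          (B := {x : ℝ | τ • (h + x • e) ∈ B}) (hB.preimage (by fun_prop))
  · have hS' : MeasurableSet {q : E × ℝ | τ • (q.1 + (‖u‖ / τ + q.2) • e) ∈ B} :=
      hB.preimage (by fun_prop)
    exact measurable_measure_prodMk_left hS'

variable {ι : Type*} [Fintype ι]

lemma measurable_sum_smul (w : ι → ℝ) : Measurable fun g : ι → E => ∑ k, w k • g k :=
  Finset.measurable_fun_sum _ fun k _ => (measurable_pi_apply k).const_smul (w k)

/-- A linear combination of independent standard Gaussian vectors is a Gaussian vector. -/
lemma map_sum_smul_pi_stdGaussian (w : ι → ℝ) {τ : ℝ} (hτ : τ ^ 2 = ∑ k, w k ^ 2) :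
    (Measure.pi fun _ : ι => stdGaussian E).map (fun g => ∑ k, w k • g k) =
      (stdGaussian E).map (fun g => τ • g) := by
  have : IsProbabilityMeasure ((Measure.pi fun _ : ι => stdGaussian E).map
    (fun g => ∑ k, w k • g k)) :=
    Measure.isProbabilityMeasure_map (measurable_sum_smul w).aemeasurable
  have : IsProbabilityMeasure ((stdGaussian E).map (fun g => τ • g)) :=
    Measure.isProbabilityMeasure_map (by fun_prop)
  refine Measure.ext_of_charFun ?_
  ext t
  rw [charFun_map_smul, charFun_stdGaussian, charFun_apply,
    integral_map (measurable_sum_smul w).aemeasurable (by fun_prop)]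
  simp_rw [sum_inner, Complex.ofReal_sum, Finset.sum_mul, Complex.exp_sum,
    integral_fintype_prod_eq_prod (f := fun k (x : E) => Complex.exp (⟪w k • x, t⟫ * Complex.I)),
    real_inner_smul_left, ← real_inner_smul_right, ← charFun_apply, charFun_stdGaussian]
  rw [← Complex.exp_sum]
  congr 1
  simp only [norm_smul, Real.norm_eq_abs, mul_pow, Complex.ofReal_mul, ← Complex.ofReal_pow,
    sq_abs, hτ, Complex.ofReal_sum]
  simp only [Finset.sum_mul, Finset.sum_div, ← Finset.sum_neg_distrib]

/-- Linear combinations of independent standard Gaussian vectors with orthogonal coefficients are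
independent. -/
lemma indepFun_sum_smul_pi_stdGaussian {κ : Type*} [Fintype κ] (w : ι → ℝ) (M : κ → ι → ℝ)
    (h : ∀ j, ∑ k, M j k * w k = 0) :
    IndepFun (fun g : ι → E => fun j => ∑ k, M j k • g k) (fun g => ∑ k, w k • g k)
      (Measure.pi fun _ : ι => stdGaussian E) := by
  classical
  have hpi : iIndepFun (fun k (g : ι → E) => g k) (Measure.pi fun _ : ι => stdGaussian E) :=
    iIndepFun_pi (X := fun _ => id) (fun _ => by fun_prop)
  have hev : ∀ k, HasGaussianLaw (fun g : ι → E => g k)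
      (Measure.pi fun _ : ι => stdGaussian E) := fun k =>
    ((measurePreserving_eval (fun _ : ι => stdGaussian E) k).hasLaw).hasGaussianLaw
  have hG : HasGaussianLaw (fun g : ι → E => fun k => g k)
      (Measure.pi fun _ : ι => stdGaussian E) := hpi.hasGaussianLaw hev
  have hG' : HasGaussianLaw (fun g : ι → E => (fun j => ∑ k, M j k • g k, ∑ k, w k • g k))
      (Measure.pi fun _ : ι => stdGaussian E) := by
    convert! hG.map_fun (F := (κ → E) × E)
      ((ContinuousLinearMap.pi fun j => ∑ k, M j k • ContinuousLinearMap.proj k).prod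
        (∑ k, w k • ContinuousLinearMap.proj k)) using 2 with g
    simp only [ContinuousLinearMap.prod_apply, ContinuousLinearMap.coe_pi']
    ext <;> simp
  refine hG'.indepFun_of_covariance_strongDual fun L₁ L₂ => ?_
  have hmem : ∀ (L : StrongDual ℝ E) k, MemLp (fun g : ι → E => L (g k)) 2
      (Measure.pi fun _ : ι => stdGaussian E) := fun L k => ((hev k).map_fun L).memLp_two
  have hcov : ∀ (L L' : StrongDual ℝ E) k l,
      cov[fun g : ι → E => L (g k), fun g => L' (g l); Measure.pi fun _ : ι => stdGaussian E] =
        if k = l then cov[L, L'; stdGaussian E] else 0 := by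
    intro L L' k l
    split_ifs with hkl
    · subst hkl
      exact (measurePreserving_eval (fun _ : ι => stdGaussian E) k).hasLaw.covariance_fun_comp
        (by fun_prop) (by fun_prop)
    · exact ((hpi.indepFun hkl).comp (φ := L) (ψ := L') (by fun_prop)
        (by fun_prop)).covariance_eq_zero (hmem L k) (hmem L' l)
  have e1 : L₁ ∘ (fun g : ι → E => fun j => ∑ k, M j k • g k) =
      fun g => ∑ q : κ × ι, M q.1 q.2 * (L₁ ∘L ContinuousLinearMap.single ℝ (fun _ => E) q.1)
        (g q.2) := by
    ext g
    rw [Fintype.sum_prod_type, Function.comp_apply]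
    conv_lhs => rw [← Finset.univ_sum_single (fun j => ∑ k, M j k • g k)]
    simp only [map_sum]
    refine Finset.sum_congr rfl fun j _ => ?_
    have : Pi.single (M := fun _ : κ => E) j (∑ k, M j k • g k) =
      ContinuousLinearMap.single ℝ (fun _ => E) j (∑ k, M j k • g k) := rfl
    rw [this, ← ContinuousLinearMap.comp_apply]
    simp only [map_sum, map_smul, smul_eq_mul]
  have e2 : L₂ ∘ (fun g : ι → E => ∑ k, w k • g k) = fun g => ∑ l, w l * L₂ (g l) := by
    ext g
    simp
  rw [e1, e2, covariance_fun_sum_fun_sum (fun q => (hmem _ _).const_mul _)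
    (fun l => (hmem _ _).const_mul _)]
  simp only [covariance_const_mul_left, covariance_const_mul_right, hcov]
  simp only [mul_ite, mul_zero, Finset.sum_ite_eq, Finset.mem_univ, if_true]
  rw [Fintype.sum_prod_type]
  refine Finset.sum_eq_zero fun j _ => ?_
  simp only [← mul_assoc]
  rw [← Finset.sum_mul]
  simp only [mul_comm (w _), h j, zero_mul]

end StdGaussian

/-! ### The norm of a Gaussian vector -/

section Norm

open scoped RealInnerProductSpace

variable {E : Type*} [NormedAddCommGroup E] [InnerProductSpace ℝ E] [FiniteDimensional ℝ E]
  [MeasurableSpace E] [BorelSpace E]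

lemma integrable_norm_sq_stdGaussian : Integrable (fun g : E => ‖g‖ ^ 2) (stdGaussian E) :=
  (IsGaussian.memLp_two_id (μ := stdGaussian E)).integrable_norm_pow (by norm_num)

lemma integral_norm_sq_stdGaussian :
    ∫ g, ‖g‖ ^ 2 ∂stdGaussian E = Module.finrank ℝ E := by
  have h1 : ∀ x : E, ‖x‖ = 1 → ∫ g, ⟪x, g⟫ ^ 2 ∂stdGaussian E = 1 := by
    intro x hx
    have h0 : ∫ g, ⟪x, g⟫ ∂stdGaussian E = 0 := integral_strongDual_stdGaussian (innerSL ℝ x)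
    rw [← variance_of_integral_eq_zero (by fun_prop) h0]
    have := variance_dual_stdGaussian (innerSL ℝ x)
    rw [innerSL_apply_norm, hx, one_pow] at this
    exact this
  have hint : ∀ x : E, Integrable (fun g => ⟪x, g⟫ ^ 2) (stdGaussian E) := fun x =>
    ((IsGaussian.hasGaussianLaw_id (μ := stdGaussian E)).map_fun
      (innerSL ℝ x)).memLp_two.integrable_sq
  set b := stdOrthonormalBasis ℝ E
  simp_rw [fun g : E => (b.sum_sq_inner_right g).symm]
  rw [integral_finsetSum _ fun i _ => hint _]
  simp [h1]

lemma integral_norm_add_smul_sq_stdGaussian (u : E) (ρ : ℝ) :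
    Integrable (fun g : E => ‖u + ρ • g‖ ^ 2) (stdGaussian E) ∧
    ∫ g, ‖u + ρ • g‖ ^ 2 ∂stdGaussian E = ‖u‖ ^ 2 + ρ ^ 2 * Module.finrank ℝ E := by
  have h0 : ∫ g, ⟪u, g⟫ ∂stdGaussian E = 0 := integral_strongDual_stdGaussian (innerSL ℝ u)
  have hi : Integrable (fun g => ⟪u, g⟫) (stdGaussian E) :=
    ((IsGaussian.hasGaussianLaw_id (μ := stdGaussian E)).map_fun (innerSL ℝ u)).integrable
  have he : (fun g : E => ‖u + ρ • g‖ ^ 2) =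
      fun g => (‖u‖ ^ 2 + 2 * ρ * ⟪u, g⟫) + ρ ^ 2 * ‖g‖ ^ 2 := by
    ext g
    rw [norm_add_sq_real, real_inner_smul_right, norm_smul, mul_pow, Real.norm_eq_abs, sq_abs]
    ring
  rw [he]
  have i1 : Integrable (fun g => ‖u‖ ^ 2 + 2 * ρ * ⟪u, g⟫) (stdGaussian E) :=
    (integrable_const _).add (hi.const_mul _)
  have i2 := (integrable_norm_sq_stdGaussian (E := E)).const_mul (ρ ^ 2)
  refine ⟨i1.add i2, ?_⟩
  rw [integral_add i1 i2, integral_add (integrable_const _) (hi.const_mul _),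
    integral_const_mul, integral_const_mul, h0, integral_norm_sq_stdGaussian]
  simp

/-- Jensen's inequality for the convex function `x ↦ Φᶜ(√x / σ)` and the squared norm of a Gaussian
vector. -/
lemma gaussianTail_le_lintegral_stdGaussian (u : E) (ρ : ℝ) {σ : ℝ} (hσ : 0 < σ)
    (h : 0 < ‖u‖ ^ 2 + ρ ^ 2 * Module.finrank ℝ E) :
    ENNReal.ofReal (gaussianTail (√(‖u‖ ^ 2 + ρ ^ 2 * Module.finrank ℝ E) / σ)) ≤
      ∫⁻ g, ENNReal.ofReal (gaussianTail (‖u + ρ • g‖ / σ)) ∂stdGaussian E := by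
  obtain ⟨hi, hv⟩ := integral_norm_add_smul_sq_stdGaussian u ρ
  set v := ‖u‖ ^ 2 + ρ ^ 2 * Module.finrank ℝ E
  set t₀ := √v / σ
  have ht₀ : 0 < t₀ := by positivity
  have hsq : t₀ ^ 2 = v / σ ^ 2 := by rw [div_pow, Real.sq_sqrt h.le]
  set K := gaussianPDFReal 0 1 t₀ / (2 * t₀)
  have hT : Integrable (fun g : E => gaussianTail (‖u + ρ • g‖ / σ)) (stdGaussian E) := by
    refine Integrable.of_bound (C := 1)
      (gaussianTail_antitone.measurable.comp (by fun_prop)).aestronglyMeasurable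
      (Filter.Eventually.of_forall fun g => ?_)
    rw [Real.norm_of_nonneg (gaussianTail_nonneg _)]
    exact gaussianTail_le_one _
  rw [← ofReal_integral_eq_lintegral_ofReal hT
    (Filter.Eventually.of_forall fun g => gaussianTail_nonneg _)]
  refine ENNReal.ofReal_le_ofReal ?_
  have hi2 : Integrable (fun g : E => K * (‖u + ρ • g‖ ^ 2 / σ ^ 2 - t₀ ^ 2)) (stdGaussian E) :=
    ((hi.div_const _).sub (integrable_const _)).const_mul _
  have hz : ∫ g, K * (‖u + ρ • g‖ ^ 2 / σ ^ 2 - t₀ ^ 2) ∂stdGaussian E = 0 := by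
    rw [integral_const_mul, integral_sub (hi.div_const _) (integrable_const _),
      integral_div, hv, hsq]
    simp
  calc gaussianTail t₀ = ∫ g, gaussianTail t₀ ∂stdGaussian E := by simp
    _ ≤ ∫ g, (gaussianTail (‖u + ρ • g‖ / σ) + K * (‖u + ρ • g‖ ^ 2 / σ ^ 2 - t₀ ^ 2))
        ∂stdGaussian E := by
      refine integral_mono (integrable_const _) (hT.add hi2) fun g => ?_
      have := le_gaussianTail_add_sq_sub_sq ht₀ (t := ‖u + ρ • g‖ / σ) (by positivity)
      rwa [div_pow _ σ] at this
    _ = _ := by rw [integral_add hT hi2, hz, add_zero]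

end Norm

section Chernoff

lemma integral_exp_neg_mul_sq_gaussianReal {b : ℝ} (hb : 0 ≤ b) :
    ∫ x, Real.exp (-(b / 2) * x ^ 2) ∂gaussianReal 0 1 = (√(1 + b))⁻¹ := by
  rw [integral_gaussianReal_eq_integral_smul one_ne_zero]
  have : ∀ x : ℝ, gaussianPDFReal 0 1 x • Real.exp (-(b / 2) * x ^ 2) =
      (√(2 * Real.pi))⁻¹ * Real.exp (-((1 + b) / 2) * x ^ 2) := by
    intro x
    simp only [gaussianPDFReal, smul_eq_mul, NNReal.coe_one, mul_one, sub_zero]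
    rw [mul_assoc, ← Real.exp_add]
    congr 2
    ring
  simp_rw [this]
  rw [integral_const_mul, integral_gaussian, ← Real.sqrt_inv, ← Real.sqrt_inv,
    ← Real.sqrt_mul (by positivity)]
  congr 1
  field_simp

lemma integral_exp_neg_mul_norm_sq_stdGaussian (p : ℕ) {b : ℝ} (hb : 0 ≤ b) :
    ∫ g, Real.exp (-(b / 2) * ‖g‖ ^ 2) ∂stdGaussian (EuclideanSpace ℝ (Fin p)) =
      (√(1 + b))⁻¹ ^ p := by
  rw [← map_pi_eq_stdGaussian, integral_map (by fun_prop) (by fun_prop)]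
  simp_rw [EuclideanSpace.real_norm_sq_eq, Finset.mul_sum, Real.exp_sum]
  rw [integral_fintype_prod_eq_prod (f := fun _ (x : ℝ) => Real.exp (-(b / 2) * x ^ 2))]
  simp only [integral_exp_neg_mul_sq_gaussianReal hb, Finset.prod_const, Finset.card_univ,
    Fintype.card_fin]

/-- Chernoff bound for the lower tail of the norm of a standard Gaussian vector. -/
lemma stdGaussian_norm_sq_lt_le (p : ℕ) {ε : ℝ} (h0 : 0 ≤ ε) (h1 : ε ≤ 1) :
    stdGaussian (EuclideanSpace ℝ (Fin p)) {g | (1 + ε) * ‖g‖ ^ 2 < p} ≤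
      ENNReal.ofReal (Real.exp (-(p * ε ^ 2 / 12))) := by
  set γ := stdGaussian (EuclideanSpace ℝ (Fin p))
  have hi : Integrable (fun g => Real.exp (ε / 2 * -‖g‖ ^ 2)) γ := by
    refine Integrable.of_bound (C := 1) (by fun_prop) (Filter.Eventually.of_forall fun g => ?_)
    rw [Real.norm_of_nonneg (Real.exp_pos _).le, Real.exp_le_one_iff]
    nlinarith [mul_nonneg h0 (sq_nonneg ‖g‖)]
  have hch := measure_ge_le_exp_mul_mgf (μ := γ) (X := fun g => -‖g‖ ^ 2) (-(p / (1 + ε)))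
    (show 0 ≤ ε / 2 by positivity) hi
  have hm : mgf (fun g => -‖g‖ ^ 2) γ (ε / 2) = (√(1 + ε))⁻¹ ^ p := by
    rw [← integral_exp_neg_mul_norm_sq_stdGaussian p h0, mgf]
    congr! 3 with g
    ring
  have hsub : {g : EuclideanSpace ℝ (Fin p) | (1 + ε) * ‖g‖ ^ 2 < p} ⊆
      {g | -(p / (1 + ε)) ≤ -‖g‖ ^ 2} := by
    intro g hg
    have hg' : (1 + ε) * ‖g‖ ^ 2 < p := hg
    show -(p / (1 + ε)) ≤ -‖g‖ ^ 2
    rw [neg_le_neg_iff, le_div_iff₀ (by positivity)]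
    linarith
  refine (measure_mono hsub).trans ?_
  rw [← ofReal_measureReal]
  refine ENNReal.ofReal_le_ofReal (hch.trans ?_)
  have hs : (√(1 + ε))⁻¹ ^ p = Real.exp (-(p * Real.log (1 + ε) / 2)) := by
    have : √(1 + ε) = Real.exp (Real.log (1 + ε) / 2) := by
      rw [← Real.log_sqrt (by positivity), Real.exp_log (by positivity)]
    rw [this, ← Real.exp_neg, ← Real.exp_nat_mul]
    congr 1
    ring
  rw [hm, hs, ← Real.exp_add, Real.exp_le_exp]
  have hlog := Real.le_log_one_add_of_nonneg h0
  have hq : ε / (1 + ε) + ε ^ 2 / 6 ≤ 2 * ε / (ε + 2) := by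
    have : 2 * ε / (ε + 2) - ε / (1 + ε) = ε ^ 2 / ((ε + 2) * (1 + ε)) := by
      field_simp
      ring
    have h6 : ε ^ 2 / 6 ≤ ε ^ 2 / ((ε + 2) * (1 + ε)) := by
      gcongr
      nlinarith
    linarith
  have hp : (0 : ℝ) ≤ p := p.cast_nonneg
  have := mul_le_mul_of_nonneg_left (hq.trans hlog) hp
  have e : -(ε / 2) * -(p / (1 + ε)) = p * (ε / (1 + ε)) / 2 := by ring
  rw [e]
  nlinarith

end Chernoff

/-! ### Gaussian priors: conditional law of one observation given the others -/

section Mixture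

variable {n p : ℕ}

lemma label_eq_one_or (η : Labels n) (i : Fin n) : label η i = 1 ∨ label η i = -1 := by
  rcases Int.units_eq_one_or (η i) with h | h <;> simp [label, h]

lemma label_mul_self (η : Labels n) (i : Fin n) : label η i * label η i = 1 := by
  rcases Int.units_eq_one_or (η i) with h | h <;> simp [label, h]

/-- The label vector `η` with the sign of its `i`-th entry reversed. -/
def flip (η : Labels n) (i : Fin n) : Labels n := Function.update η i (-η i)

lemma label_flip_self (η : Labels n) (i : Fin n) : label (flip η i) i = -label η i := by
  simp [label, flip]

lemma label_flip_of_ne (η : Labels n) {i j : Fin n} (h : j ≠ i) :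
    label (flip η i) j = label η j := by
  simp [label, flip, h]

lemma law_apply (σ : ℝ) (θ : EuclideanSpace ℝ (Fin p)) (η : Labels n) {A : Set (Observations n p)}
    (hA : MeasurableSet A) :
    law n p σ θ η A = (Measure.pi fun _ : Fin n => stdGaussian (EuclideanSpace ℝ (Fin p)))
      {ξ | (fun i => label η i • θ + σ • ξ i) ∈ A} := by
  rw [law, Measure.map_apply (by fun_prop) hA]
  rfl

instance (σ : ℝ) (θ : EuclideanSpace ℝ (Fin p)) (η : Labels n) :
    IsProbabilityMeasure (law n p σ θ η) :=
  Measure.isProbabilityMeasure_map (Measurable.aemeasurable (by fun_prop))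

lemma measurable_law_apply (σ : ℝ) (η : Labels n) {A : Set (Observations n p)}
    (hA : MeasurableSet A) : Measurable fun θ => law n p σ θ η A := by
  simp_rw [law_apply σ _ η hA]
  have hS : MeasurableSet {q : EuclideanSpace ℝ (Fin p) × Observations n p |
      (fun i => label η i • q.1 + σ • q.2 i) ∈ A} := hA.preimage (by fun_prop)
  exact measurable_measure_prodMk_left hS

/-- The observations when `θ` has the prior `N(θ₀, α² I)`, as a function of `n + 1` independent
standard Gaussian vectors, of which the first one generates `θ`. -/
noncomputable def mixedObservations (σ α : ℝ) (θ₀ : EuclideanSpace ℝ (Fin p)) (η : Labels n)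
    (G : Fin (n + 1) → EuclideanSpace ℝ (Fin p)) : Observations n p :=
  fun j => label η j • (θ₀ + α • G 0) + σ • G j.succ

lemma lintegral_law_apply (σ α : ℝ) (θ₀ : EuclideanSpace ℝ (Fin p)) (η : Labels n)
    {A : Set (Observations n p)} (hA : MeasurableSet A) :
    ∫⁻ g, law n p σ (θ₀ + α • g) η A ∂stdGaussian (EuclideanSpace ℝ (Fin p)) =
      (Measure.pi fun _ : Fin (n + 1) => stdGaussian (EuclideanSpace ℝ (Fin p)))
        {G | mixedObservations σ α θ₀ η G ∈ A} := by
  have hS : MeasurableSet {q : EuclideanSpace ℝ (Fin p) × Observations n p |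
      (fun i => label η i • (θ₀ + α • q.1) + σ • q.2 i) ∈ A} := hA.preimage (by fun_prop)
  have h := (measurePreserving_piFinSuccAbove
    (fun _ : Fin (n + 1) => stdGaussian (EuclideanSpace ℝ (Fin p))) 0).measure_preimage
    hS.nullMeasurableSet
  rw [Measure.prod_apply hS] at h
  simp_rw [law_apply σ _ η hA]
  exact h.symm

/-- Coefficients, in terms of the `n + 1` Gaussian vectors, of the centred observations, with the
`i`-th one replaced by `0`. -/
noncomputable def othersCoeff (σ α : ℝ) (η : Labels n) (i j : Fin n) (k : Fin (n + 1)) : ℝ :=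
  if j = i then 0 else
    Fin.cases (α * label η j) (fun l => if l = j then σ else 0) k

/-- Coefficients of the difference between the `i`-th observation and its conditional mean given
the others, when `c` is the regression coefficient. -/
noncomputable def residualCoeff (σ α c : ℝ) (η : Labels n) (i : Fin n) (k : Fin (n + 1)) : ℝ :=
  Fin.cases (label η i * (α * (1 - c * (n - 1))))
    (fun l => if l = i then σ else -(label η i * (c * σ * label η l))) k

/-- Coefficients of the centred conditional mean of `θ` given the observations other than the
`i`-th one. -/
noncomputable def meanCoeff (σ α c : ℝ) (η : Labels n) (i : Fin n) (k : Fin (n + 1)) : ℝ :=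
  Fin.cases (c * (n - 1) * α) (fun l => if l = i then 0 else c * σ * label η l) k

lemma othersCoeff_flip (σ α : ℝ) (η : Labels n) (i : Fin n) :
    othersCoeff σ α (flip η i) i = othersCoeff σ α η i := by
  ext j k
  unfold othersCoeff
  split_ifs with h
  · rfl
  · rw [label_flip_of_ne η h]

lemma sum_othersCoeff_smul (σ α : ℝ) (η : Labels n) (i j : Fin n)
    (G : Fin (n + 1) → EuclideanSpace ℝ (Fin p)) :
    ∑ k, othersCoeff σ α η i j k • G k =
      if j = i then 0 else (α * label η j) • G 0 + σ • G j.succ := by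
  split_ifs with h
  · simp [othersCoeff, h]
  · simp [othersCoeff, h, Fin.sum_univ_succ, ite_smul]

lemma sum_erase_const (i : Fin n) (x : ℝ) : ∑ _j ∈ Finset.univ.erase i, x = (n - 1) * x := by
  have : 0 < n := i.pos
  rw [Finset.sum_const, Finset.card_erase_of_mem (Finset.mem_univ i), Finset.card_univ,
    Fintype.card_fin, nsmul_eq_mul, Nat.cast_sub this, Nat.cast_one]

lemma sum_fin_succ_erase {F : Type*} [AddCommMonoid F] (f : Fin (n + 1) → F) (i : Fin n) :
    ∑ k, f k = f 0 + (f i.succ + ∑ l ∈ Finset.univ.erase i, f l.succ) := by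
  rw [Fin.sum_univ_succ, Finset.add_sum_erase _ (fun l => f l.succ) (Finset.mem_univ i)]

lemma sum_residualCoeff_sq (σ α c : ℝ) (η : Labels n) (i : Fin n) :
    ∑ k, residualCoeff σ α c η i k ^ 2 =
      (α * (1 - c * (n - 1))) ^ 2 + (σ ^ 2 + (n - 1) * (c * σ) ^ 2) := by
  rw [sum_fin_succ_erase _ i, ← sum_erase_const i]
  congr 1
  · simp only [residualCoeff, Fin.cases_zero]
    linear_combination (α * (1 - c * (n - 1))) ^ 2 * label_mul_self η i
  congr 1
  · simp [residualCoeff]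
  · refine Finset.sum_congr rfl fun l hl => ?_
    simp only [residualCoeff, Fin.cases_succ, Finset.ne_of_mem_erase hl, if_false]
    linear_combination (c * σ) ^ 2 * label η l * label η l * label_mul_self η i +
      (c * σ) ^ 2 * label_mul_self η l

lemma sum_meanCoeff_sq (σ α c : ℝ) (η : Labels n) (i : Fin n) :
    ∑ k, meanCoeff σ α c η i k ^ 2 = (n - 1) * c ^ 2 * ((n - 1) * α ^ 2 + σ ^ 2) := by
  have : ∑ k, meanCoeff σ α c η i k ^ 2 =
      (c * (n - 1) * α) ^ 2 + (0 + ∑ l ∈ Finset.univ.erase i, (c * σ) ^ 2) := by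
    rw [sum_fin_succ_erase _ i]
    congr 1
    congr 1
    · simp [meanCoeff]
    · refine Finset.sum_congr rfl fun l hl => ?_
      simp only [meanCoeff, Fin.cases_succ, Finset.ne_of_mem_erase hl, if_false]
      linear_combination (c * σ) ^ 2 * label_mul_self η l
  rw [this, sum_erase_const]
  ring

lemma sum_othersCoeff_mul_residualCoeff {σ α c : ℝ} (η : Labels n) (i : Fin n)
    (hc : c * ((n - 1) * α ^ 2 + σ ^ 2) = α ^ 2) (j : Fin n) :
    ∑ k, othersCoeff σ α η i j k * residualCoeff σ α c η i k = 0 := by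
  by_cases h : j = i
  · simp [othersCoeff, h]
  · simp only [othersCoeff, residualCoeff, h, if_false, Fin.sum_univ_succ, Fin.cases_zero,
      Fin.cases_succ, ite_mul, zero_mul, Finset.sum_ite_eq', Finset.mem_univ, if_true]
    linear_combination -label η i * label η j * hc

lemma smul_sum_label_smul (σ α c : ℝ) (η : Labels n) (i : Fin n)
    (G : Fin (n + 1) → EuclideanSpace ℝ (Fin p)) :
    c • ∑ j ∈ Finset.univ.erase i, label η j • ∑ k, othersCoeff σ α η i j k • G k =
      ∑ k, meanCoeff σ α c η i k • G k := by
  have h1 : ∀ j ∈ Finset.univ.erase i, label η j • ∑ k, othersCoeff σ α η i j k • G k =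
      α • G 0 + (σ * label η j) • G j.succ := by
    intro j hj
    rw [sum_othersCoeff_smul, if_neg (Finset.ne_of_mem_erase hj), smul_add, smul_smul, smul_smul]
    congr 2
    · linear_combination α * label_mul_self η j
    · ring
  have h3 : ∑ _j ∈ Finset.univ.erase i, c • α • G 0 = c • ((n - 1) * α) • G 0 := by
    rw [← sum_erase_const i, Finset.sum_smul, Finset.smul_sum]
  have h2 : ∀ j ∈ Finset.univ.erase i, meanCoeff σ α c η i j.succ • G j.succ =
      c • (σ * label η j) • G j.succ := by
    intro j hj
    simp only [meanCoeff, Fin.cases_succ, Finset.ne_of_mem_erase hj, if_false, smul_smul]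
    congr 1
    ring
  rw [Finset.sum_congr rfl h1, sum_fin_succ_erase _ i, Finset.sum_congr rfl h2,
    Finset.sum_add_distrib, smul_add, Finset.smul_sum, h3, Finset.smul_sum]
  simp [meanCoeff, smul_smul, mul_assoc]

lemma sum_residualCoeff_smul (σ α c : ℝ) (η : Labels n) (i : Fin n)
    (G : Fin (n + 1) → EuclideanSpace ℝ (Fin p)) :
    label η i • (∑ k, meanCoeff σ α c η i k • G k) + ∑ k, residualCoeff σ α c η i k • G k =
      label η i • α • G 0 + σ • G i.succ := by
  rw [Finset.smul_sum, ← Finset.sum_add_distrib, sum_fin_succ_erase _ i, Finset.sum_eq_zero]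
  · simp only [meanCoeff, residualCoeff, Fin.cases_zero, Fin.cases_succ, if_true]
    module
  · intro l hl
    simp only [meanCoeff, residualCoeff, Fin.cases_succ, Finset.ne_of_mem_erase hl, if_false]
    module

/-- The conditional mean of `θ` given the observations other than the `i`-th one, as a function of
their centred values `v`; `c` is the regression coefficient. -/
noncomputable def posteriorMean (c : ℝ) (θ₀ : EuclideanSpace ℝ (Fin p)) (η : Labels n) (i : Fin n)
    (v : Observations n p) : EuclideanSpace ℝ (Fin p) :=
  θ₀ + c • ∑ j ∈ Finset.univ.erase i, label η j • v j

lemma measurable_posteriorMean (c : ℝ) (θ₀ : EuclideanSpace ℝ (Fin p)) (η : Labels n)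
    (i : Fin n) : Measurable (posteriorMean c θ₀ η i) := by
  unfold posteriorMean
  fun_prop

lemma posteriorMean_flip (c : ℝ) (θ₀ : EuclideanSpace ℝ (Fin p)) (η : Labels n) (i : Fin n) :
    posteriorMean c θ₀ (flip η i) i = posteriorMean c θ₀ η i := by
  ext1 v
  unfold posteriorMean
  congr 2
  exact Finset.sum_congr rfl fun j hj => by rw [label_flip_of_ne η (Finset.ne_of_mem_erase hj)]

/-- The observation vector whose `i`-th entry is `x` and whose other centred entries are `v`. -/
noncomputable def assemble (θ₀ : EuclideanSpace ℝ (Fin p)) (η : Labels n) (i : Fin n)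
    (v : Observations n p) (x : EuclideanSpace ℝ (Fin p)) : Observations n p :=
  fun j => if j = i then x else label η j • θ₀ + v j

lemma assemble_flip (θ₀ : EuclideanSpace ℝ (Fin p)) (η : Labels n) (i : Fin n) :
    assemble θ₀ (flip η i) i = assemble θ₀ η i := by
  ext1 v
  ext1 x
  ext1 j
  unfold assemble
  split_ifs with h
  · rfl
  · rw [label_flip_of_ne η h]

lemma measurable_assemble (θ₀ : EuclideanSpace ℝ (Fin p)) (η : Labels n) (i : Fin n) :
    Measurable fun q : Observations n p × EuclideanSpace ℝ (Fin p) =>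
      assemble θ₀ η i q.1 q.2 := by
  refine measurable_pi_lambda _ fun j => ?_
  unfold assemble
  split_ifs <;> fun_prop

lemma mixedObservations_eq_assemble (σ α c : ℝ) (θ₀ : EuclideanSpace ℝ (Fin p)) (η : Labels n)
    (i : Fin n) (G : Fin (n + 1) → EuclideanSpace ℝ (Fin p)) :
    mixedObservations σ α θ₀ η G = assemble θ₀ η i (fun j => ∑ k, othersCoeff σ α η i j k • G k)
      (label η i • posteriorMean c θ₀ η i (fun j => ∑ k, othersCoeff σ α η i j k • G k) +
        ∑ k, residualCoeff σ α c η i k • G k) := by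
  ext1 j
  unfold assemble mixedObservations
  split_ifs with h
  · subst h
    rw [posteriorMean, smul_sum_label_smul, smul_add, smul_add, add_assoc, add_assoc,
      sum_residualCoeff_smul]
  · simp only [sum_othersCoeff_smul, if_neg h]
    module

/-- Given the other observations, the `i`-th one is Gaussian with mean `ηᵢ` times the conditional
mean of `θ`. -/
lemma lintegral_law_eq_lintegral_posteriorMean {σ α c τ : ℝ} (θ₀ : EuclideanSpace ℝ (Fin p))
    (η : Labels n) (i : Fin n) (hc : c * ((n - 1) * α ^ 2 + σ ^ 2) = α ^ 2)
    (hτ : τ ^ 2 = (α * (1 - c * (n - 1))) ^ 2 + (σ ^ 2 + (n - 1) * (c * σ) ^ 2))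
    {A : Set (Observations n p)} (hA : MeasurableSet A) :
    ∫⁻ g, law n p σ (θ₀ + α • g) η A ∂stdGaussian (EuclideanSpace ℝ (Fin p)) =
      ∫⁻ v, stdGaussian (EuclideanSpace ℝ (Fin p))
          {g | label η i • posteriorMean c θ₀ η i v + τ • g ∈ {x | assemble θ₀ η i v x ∈ A}}
        ∂(Measure.pi fun _ : Fin (n + 1) => stdGaussian (EuclideanSpace ℝ (Fin p))).map
          (fun G j => ∑ k, othersCoeff σ α η i j k • G k) := by
  have hind := indepFun_sum_smul_pi_stdGaussian (E := EuclideanSpace ℝ (Fin p))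
    (residualCoeff σ α c η i) (othersCoeff σ α η i) (sum_othersCoeff_mul_residualCoeff η i hc)
  have hV : Measurable fun (G : Fin (n + 1) → EuclideanSpace ℝ (Fin p)) (j : Fin n) =>
      ∑ k, othersCoeff σ α η i j k • G k :=
    measurable_pi_lambda _ fun j => measurable_sum_smul _
  have hW := measurable_sum_smul (E := EuclideanSpace ℝ (Fin p)) (residualCoeff σ α c η i)
  have : IsProbabilityMeasure ((stdGaussian (EuclideanSpace ℝ (Fin p))).map (fun g => τ • g)) :=
    Measure.isProbabilityMeasure_map (by fun_prop)
  rw [indepFun_iff_map_prod_eq_prod_map_map hV.aemeasurable hW.aemeasurable,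
    map_sum_smul_pi_stdGaussian _ (hτ.trans (sum_residualCoeff_sq σ α c η i).symm)] at hind
  have hS : MeasurableSet {q : Observations n p × EuclideanSpace ℝ (Fin p) |
      assemble θ₀ η i q.1 (label η i • posteriorMean c θ₀ η i q.1 + q.2) ∈ A} := by
    refine hA.preimage ((measurable_assemble θ₀ η i).comp (measurable_fst.prodMk ?_))
    have := measurable_posteriorMean c θ₀ η i
    fun_prop
  have h := congrArg (fun μ => μ {q : Observations n p × EuclideanSpace ℝ (Fin p) |
      assemble θ₀ η i q.1 (label η i • posteriorMean c θ₀ η i q.1 + q.2) ∈ A}) hind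
  rw [Measure.map_apply (hV.prodMk hW) hS, Measure.prod_apply hS] at h
  rw [lintegral_law_apply σ α θ₀ η hA]
  simp_rw [mixedObservations_eq_assemble σ α c θ₀ η i]
  refine h.trans (lintegral_congr fun v => ?_)
  rw [Measure.map_apply (by fun_prop) (hS.preimage measurable_prodMk_left)]
  rfl

/-- Under the prior `N(θ₀, α² I)` for `θ`, no test can distinguish the two signs of the `i`-th label
with a sum of errors below `2 Φᶜ(t)`, even if it knows all other labels. Here `σ t` is the root
mean square of the norm of the conditional mean of `θ` given the other observations. -/
lemma two_mul_gaussianTail_le_lintegral_law {σ : ℝ} (hσ : 0 < σ) (α : ℝ)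
    (θ₀ : EuclideanSpace ℝ (Fin p)) (η : Labels n) (i : Fin n)
    (hpos : 0 < ‖θ₀‖ ^ 2 + (n - 1) * α ^ 4 / ((n - 1) * α ^ 2 + σ ^ 2) * p)
    {A : Set (Observations n p)} (hA : MeasurableSet A) :
    ENNReal.ofReal (2 * gaussianTail
        (√(‖θ₀‖ ^ 2 + (n - 1) * α ^ 4 / ((n - 1) * α ^ 2 + σ ^ 2) * p) / σ)) ≤
      ∫⁻ g, law n p σ (θ₀ + α • g) η A ∂stdGaussian (EuclideanSpace ℝ (Fin p)) +
      ∫⁻ g, law n p σ (θ₀ + α • g) (flip η i) Aᶜ ∂stdGaussian (EuclideanSpace ℝ (Fin p)) := by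
  have hm : (0 : ℝ) ≤ n - 1 := by
    have : (1 : ℝ) ≤ n := by exact_mod_cast i.pos
    linarith
  have hD : 0 < (n - 1) * α ^ 2 + σ ^ 2 := by positivity
  set c := α ^ 2 / ((n - 1) * α ^ 2 + σ ^ 2) with hc_def
  have hc : c * ((n - 1) * α ^ 2 + σ ^ 2) = α ^ 2 := div_mul_cancel₀ _ hD.ne'
  -- The residual has standard deviation `τ ≥ σ`, and smaller noise makes the test easier.
  set τ := √((α * (1 - c * (n - 1))) ^ 2 + (σ ^ 2 + (n - 1) * (c * σ) ^ 2)) with hτ_def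
  have hτ : τ ^ 2 = (α * (1 - c * (n - 1))) ^ 2 + (σ ^ 2 + (n - 1) * (c * σ) ^ 2) :=
    Real.sq_sqrt (by positivity)
  have hστ : σ ≤ τ := Real.le_sqrt_of_sq_le (by
    have : 0 ≤ (α * (1 - c * (n - 1))) ^ 2 + (n - 1) * (c * σ) ^ 2 := by positivity
    linarith)
  set ρ := √((n - 1) * α ^ 4 / ((n - 1) * α ^ 2 + σ ^ 2)) with hρ_def
  have hρ0 : ρ ^ 2 = (n - 1) * α ^ 4 / ((n - 1) * α ^ 2 + σ ^ 2) := Real.sq_sqrt (by positivity)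
  have hρ : ρ ^ 2 = ∑ k, meanCoeff σ α c η i k ^ 2 := by
    rw [sum_meanCoeff_sq, hρ0, hc_def]
    field_simp
  rw [lintegral_law_eq_lintegral_posteriorMean θ₀ η i hc hτ hA,
    lintegral_law_eq_lintegral_posteriorMean θ₀ (flip η i) i hc hτ hA.compl]
  simp only [othersCoeff_flip, posteriorMean_flip, assemble_flip, label_flip_self]
  have hV : Measurable fun (G : Fin (n + 1) → EuclideanSpace ℝ (Fin p)) (j : Fin n) =>
      ∑ k, othersCoeff σ α η i j k • G k :=
    measurable_pi_lambda _ fun j => measurable_sum_smul _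
  set ν := (Measure.pi fun _ : Fin (n + 1) => stdGaussian (EuclideanSpace ℝ (Fin p))).map
    (fun G (j : Fin n) => ∑ k, othersCoeff σ α η i j k • G k) with hν
  have hpm := measurable_posteriorMean c θ₀ η i
  have hlaw : ν.map (posteriorMean c θ₀ η i) =
      (stdGaussian (EuclideanSpace ℝ (Fin p))).map (fun g => θ₀ + ρ • g) := by
    have h1 : (stdGaussian (EuclideanSpace ℝ (Fin p))).map (fun g => θ₀ + ρ • g) =
        ((stdGaussian (EuclideanSpace ℝ (Fin p))).map (fun g => ρ • g)).map (fun x => θ₀ + x) := by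
      rw [Measure.map_map (by fun_prop) (by fun_prop)]
      rfl
    rw [h1, ← map_sum_smul_pi_stdGaussian _ hρ,
      Measure.map_map (by fun_prop) (measurable_sum_smul _), hν, Measure.map_map hpm hV]
    congr 1
    ext1 G
    simp only [Function.comp_apply, posteriorMean, smul_sum_label_smul]
  have hmeasT : Measurable fun x : EuclideanSpace ℝ (Fin p) =>
      ENNReal.ofReal (2 * gaussianTail (‖x‖ / σ)) := by
    have := gaussianTail_antitone.measurable
    fun_prop
  have hJ := gaussianTail_le_lintegral_stdGaussian θ₀ ρ hσ (by
    rw [hρ0, finrank_euclideanSpace_fin]; exact hpos)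
  rw [hρ0, finrank_euclideanSpace_fin] at hJ
  calc ENNReal.ofReal (2 * gaussianTail
        (√(‖θ₀‖ ^ 2 + (n - 1) * α ^ 4 / ((n - 1) * α ^ 2 + σ ^ 2) * p) / σ))
      ≤ ∫⁻ g, ENNReal.ofReal (2 * gaussianTail (‖θ₀ + ρ • g‖ / σ))
          ∂stdGaussian (EuclideanSpace ℝ (Fin p)) := by
        simp_rw [ENNReal.ofReal_mul zero_le_two]
        rw [lintegral_const_mul' _ _ ENNReal.ofReal_ne_top]
        gcongr
    _ = ∫⁻ v, ENNReal.ofReal (2 * gaussianTail (‖posteriorMean c θ₀ η i v‖ / σ)) ∂ν := by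
        rw [← lintegral_map (f := fun x => ENNReal.ofReal (2 * gaussianTail (‖x‖ / σ)))
          (g := posteriorMean c θ₀ η i) hmeasT hpm, hlaw,
          lintegral_map hmeasT (by fun_prop)]
    _ ≤ ∫⁻ v, (stdGaussian (EuclideanSpace ℝ (Fin p)) {g | label η i • posteriorMean c θ₀ η i v
            + τ • g ∈ {x | assemble θ₀ η i v x ∈ A}} +
          stdGaussian (EuclideanSpace ℝ (Fin p)) {g | -label η i • posteriorMean c θ₀ η i v
            + τ • g ∈ {x | assemble θ₀ η i v x ∈ Aᶜ}}) ∂ν := by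
        refine lintegral_mono fun v => ?_
        have hB : MeasurableSet {x | assemble θ₀ η i v x ∈ A} :=
          hA.preimage ((measurable_assemble θ₀ η i).comp measurable_prodMk_left)
        have h := two_mul_gaussianTail_le_stdGaussian (label η i • posteriorMean c θ₀ η i v)
          (hσ.trans_le hστ) hB
        have hlab : |label η i| = 1 := by
          rcases label_eq_one_or η i with h | h <;> simp [h]
        rw [norm_smul, Real.norm_eq_abs, hlab, one_mul] at h
        rw [neg_smul]
        refine le_trans (ENNReal.ofReal_le_ofReal ?_) h
        have := gaussianTail_antitone (div_le_div_of_nonneg_left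
          (norm_nonneg (posteriorMean c θ₀ η i v)) hσ hστ)
        linarith
    _ = _ := by
        refine lintegral_add_left ?_ _
        have hS : MeasurableSet {q : Observations n p × EuclideanSpace ℝ (Fin p) |
            assemble θ₀ η i q.1 (label η i • posteriorMean c θ₀ η i q.1 + τ • q.2) ∈ A} := by
          refine hA.preimage ((measurable_assemble θ₀ η i).comp (measurable_fst.prodMk ?_))
          fun_prop
        exact measurable_measure_prodMk_left hS

end Mixture

/-! ### From the clustering loss to tests of single labels -/

section Reduction

variable {n p : ℕ}

lemma label_neg (η : Labels n) (i : Fin n) : label (-η) i = -label η i := by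
  simp [label]

lemma hamming_eq_sub (f η : Labels n) : hamming f η = n - ∑ j, label f j * label η j := by
  have : ∀ j, |label f j - label η j| = 1 - label f j * label η j := by
    intro j
    rcases label_eq_one_or f j with h | h <;> rcases label_eq_one_or η j with h' | h' <;>
      rw [h, h'] <;> norm_num
  simp [hamming, this]

lemma loss_eq_min (f η : Labels n) :
    loss f η = min (n - ∑ j, label f j * label η j) (n + ∑ j, label f j * label η j) := by
  rw [loss, hamming_eq_sub, hamming_eq_sub]
  simp [label_neg]

lemma loss_le (f η : Labels n) : loss f η ≤ n := by
  rw [loss_eq_min]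
  rcases le_total 0 (∑ j, label f j * label η j) with h | h
  · exact (min_le_left _ _).trans (by linarith)
  · exact (min_le_right _ _).trans (by linarith)

/-- The loss dominates the number, divided by `n`, of pairs whose relative sign is estimated
wrongly. Relative signs are unaffected by a global change of sign. -/
lemma sum_ite_le_loss (f η : Labels n) :
    (n : ℝ)⁻¹ * ∑ i, ∑ j, (if f i * f j = η i * η j then 0 else 1) ≤ loss f η := by
  set a : Fin n → ℝ := fun j => label f j * label η j with ha
  -- With `S = ∑ aⱼ`, the left side is `(n² - S²) / (2n)` and the loss is `n - |S|`.
  set S := ∑ j, a j with hS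
  have hpair : ∀ i j, (if f i * f j = η i * η j then (0 : ℝ) else 1) = (1 - a i * a j) / 2 := by
    intro i j
    simp only [ha, label]
    rcases Int.units_eq_one_or (f i) with h1 | h1 <;>
      rcases Int.units_eq_one_or (f j) with h2 | h2 <;>
      rcases Int.units_eq_one_or (η i) with h3 | h3 <;>
      rcases Int.units_eq_one_or (η j) with h4 | h4 <;> simp [h1, h2, h3, h4]
  have hsum : ∑ i, ∑ j, (if f i * f j = η i * η j then (0 : ℝ) else 1) = (n ^ 2 - S ^ 2) / 2 := by
    simp_rw [hpair]
    simp only [← Finset.sum_div, Finset.sum_sub_distrib, ← Finset.mul_sum, ← Finset.sum_mul, ← hS]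
    simp
    ring
  have habs : ∀ j, |a j| ≤ 1 := by
    intro j
    simp only [ha]
    rcases label_eq_one_or f j with h | h <;> rcases label_eq_one_or η j with h' | h' <;>
      simp [h, h']
  have hSn : |S| ≤ n := by
    refine (Finset.abs_sum_le_sum_abs _ _).trans ((Finset.sum_le_sum fun j _ => habs j).trans ?_)
    simp
  obtain ⟨h1, h2⟩ := abs_le.1 hSn
  rw [hsum, loss_eq_min]
  rcases Nat.eq_zero_or_pos n with h0 | h0
  · subst h0
    simp
  have hn : (0 : ℝ) < n := by exact_mod_cast h0
  rw [inv_mul_le_iff₀ hn]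
  rcases min_choice ((n : ℝ) - S) (n + S) with h | h <;> rw [h] <;> nlinarith

/-- The event that the relative sign of the labels `i` and `j` is estimated wrongly. -/
def pairError (est : Estimator n p) (η : Labels n) (i j : Fin n) : Set (Observations n p) :=
  {Y | est.1 Y i * est.1 Y j ≠ η i * η j}

lemma measurableSet_pairError (est : Estimator n p) (η : Labels n) (i j : Fin n) :
    MeasurableSet (pairError est η i j) := by
  have h : ∀ k, Measurable fun Y => ((est.1 Y k : ℤˣ) : ℤ) := fun k =>
    (comap_measurable Units.val).comp ((measurable_pi_apply k).comp est.2)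
  have he : pairError est η i j =
      {Y | ((est.1 Y i : ℤˣ) : ℤ) * ((est.1 Y j : ℤˣ) : ℤ) = ((η i * η j : ℤˣ) : ℤ)}ᶜ := by
    ext Y
    simp only [pairError, Set.mem_ofPred_eq, Set.mem_compl_iff, ← Units.val_mul, Units.val_inj,
      ne_eq]
  rw [he]
  exact (measurableSet_eq_fun ((h i).mul (h j)) measurable_const).compl

lemma pairError_flip (est : Estimator n p) (η : Labels n) {i j : Fin n} (h : j ≠ i) :
    pairError est (flip η i) i j = (pairError est η i j)ᶜ := by
  ext Y
  simp only [pairError, flip, Set.mem_ofPred_eq, Set.mem_compl_iff, Function.update_self,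
    Function.update_of_ne h]
  rcases Int.units_eq_one_or (est.1 Y i * est.1 Y j) with h1 | h1 <;>
    rcases Int.units_eq_one_or (η i) with h3 | h3 <;>
    rcases Int.units_eq_one_or (η j) with h4 | h4 <;> simp [h1, h3, h4]

lemma sum_law_pairError_le_risk (σ : ℝ) (est : Estimator n p) (θ : EuclideanSpace ℝ (Fin p))
    (η : Labels n) :
    (n : ENNReal)⁻¹ * ((n : ENNReal)⁻¹ * ∑ i, ∑ j, law n p σ θ η (pairError est η i j)) ≤
      risk σ est θ η := by
  rw [risk]
  gcongr
  have h1 : ∀ i j, law n p σ θ η (pairError est η i j) =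
      ∫⁻ Y, (pairError est η i j).indicator 1 Y ∂law n p σ θ η := fun i j =>
    (lintegral_indicator_one (measurableSet_pairError est η i j)).symm
  have hm : ∀ i j, Measurable ((pairError est η i j).indicator (1 : Observations n p → ENNReal)) :=
    fun i j => measurable_one.indicator (measurableSet_pairError est η i j)
  simp_rw [h1]
  have h2 : ∑ i, ∑ j, ∫⁻ Y, (pairError est η i j).indicator 1 Y ∂law n p σ θ η =
      ∫⁻ Y, ∑ i, ∑ j, (pairError est η i j).indicator 1 Y ∂law n p σ θ η := by
    rw [lintegral_finsetSum _ fun i _ => Finset.measurable_fun_sum _ fun j _ => hm i j]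
    exact Finset.sum_congr rfl fun i _ => (lintegral_finsetSum _ fun j _ => hm i j).symm
  rw [h2, ← lintegral_const_mul _ (Finset.measurable_fun_sum _ fun i _ =>
    Finset.measurable_fun_sum _ fun j _ => hm i j)]
  refine lintegral_mono fun Y => ?_
  rcases Nat.eq_zero_or_pos n with h0 | h0
  · subst h0
    simp
  refine le_trans (le_of_eq ?_) (ENNReal.ofReal_le_ofReal (sum_ite_le_loss (est.1 Y) η))
  rw [ENNReal.ofReal_mul (by positivity), ENNReal.ofReal_inv_of_pos (by exact_mod_cast h0),
    ENNReal.ofReal_natCast,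
    ENNReal.ofReal_sum_of_nonneg fun i _ => Finset.sum_nonneg fun j _ => by split_ifs <;> simp]
  congr 1
  refine Finset.sum_congr rfl fun i _ => ?_
  rw [ENNReal.ofReal_sum_of_nonneg fun j _ => by split_ifs <;> simp]
  refine Finset.sum_congr rfl fun j _ => ?_
  simp only [Set.indicator, pairError, Set.mem_ofPred_eq, Pi.one_apply]
  split_ifs <;> simp_all

lemma risk_le_one (σ : ℝ) (est : Estimator n p) (θ : EuclideanSpace ℝ (Fin p)) (η : Labels n) :
    risk σ est θ η ≤ 1 := by
  rw [risk]
  calc (n : ENNReal)⁻¹ * ∫⁻ Y, ENNReal.ofReal (loss (est.1 Y) η) ∂law n p σ θ η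
      ≤ (n : ENNReal)⁻¹ * ∫⁻ _, (n : ENNReal) ∂law n p σ θ η := by
        gcongr with Y
        rw [← ENNReal.ofReal_natCast]
        exact ENNReal.ofReal_le_ofReal (loss_le _ _)
    _ ≤ 1 := by
        rw [lintegral_const, measure_univ, mul_one]
        exact ENNReal.inv_mul_le_one _

lemma flip_flip (η : Labels n) (i : Fin n) : flip (flip η i) i = η := by
  simp [flip]

/-- Bayes lower bound: the labels have the uniform prior and `θ` the prior `N(θ₀, α² I)`, whose
mass outside the parameter set enters as an error term. -/
lemma gaussianTail_le_two_mul_iSup_risk (hn : 2 ≤ n) {σ : ℝ} (hσ : 0 < σ) (Δ α : ℝ)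
    (θ₀ : EuclideanSpace ℝ (Fin p))
    (hpos : 0 < ‖θ₀‖ ^ 2 + (n - 1) * α ^ 4 / ((n - 1) * α ^ 2 + σ ^ 2) * p)
    (est : Estimator n p) :
    ENNReal.ofReal (gaussianTail
        (√(‖θ₀‖ ^ 2 + (n - 1) * α ^ 4 / ((n - 1) * α ^ 2 + σ ^ 2) * p) / σ)) ≤
      2 * ((⨆ x ∈ parameterSet n p Δ, risk σ est x.1 x.2) +
        stdGaussian (EuclideanSpace ℝ (Fin p)) {g | ‖θ₀ + α • g‖ < Δ}) := by
  set T := gaussianTail (√(‖θ₀‖ ^ 2 + (n - 1) * α ^ 4 / ((n - 1) * α ^ 2 + σ ^ 2) * p) / σ)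
    with hT
  set γ := stdGaussian (EuclideanSpace ℝ (Fin p)) with hγ
  set R := (⨆ x ∈ parameterSet n p Δ, risk σ est x.1 x.2) with hR
  set q := γ {g | ‖θ₀ + α • g‖ < Δ} with hq
  set L : Labels n → Fin n → Fin n → ENNReal := fun η i j =>
    ∫⁻ g, law n p σ (θ₀ + α • g) η (pairError est η i j) ∂γ with hL
  have hS : MeasurableSet {g : EuclideanSpace ℝ (Fin p) | ‖θ₀ + α • g‖ < Δ} :=
    measurableSet_lt (by fun_prop) (by fun_prop)
  have hupper : ∀ η, (n : ENNReal)⁻¹ * ((n : ENNReal)⁻¹ * ∑ i, ∑ j, L η i j) ≤ R + q := by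
    intro η
    have hm : ∀ i j, Measurable fun g =>
        law n p σ (θ₀ + α • g) η (pairError est η i j) := fun i j =>
      (measurable_law_apply σ η (measurableSet_pairError est η i j)).comp
        (g := fun θ => law n p σ θ η (pairError est η i j)) (f := fun g => θ₀ + α • g)
        (by fun_prop)
    have h1 : ∑ i, ∑ j, L η i j =
        ∫⁻ g, ∑ i, ∑ j, law n p σ (θ₀ + α • g) η (pairError est η i j) ∂γ := by
      rw [lintegral_finsetSum _ fun i _ => Finset.measurable_fun_sum _ fun j _ => hm i j]
      exact Finset.sum_congr rfl fun i _ => (lintegral_finsetSum _ fun j _ => hm i j).symm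
    have hm' : Measurable fun g =>
        ∑ i, ∑ j, law n p σ (θ₀ + α • g) η (pairError est η i j) :=
      Finset.measurable_fun_sum _ fun i _ => Finset.measurable_fun_sum _ fun j _ => hm i j
    rw [h1, ← lintegral_const_mul _ hm', ← lintegral_const_mul _ (hm'.const_mul _)]
    calc _ ≤ ∫⁻ g, (R + {g | ‖θ₀ + α • g‖ < Δ}.indicator 1 g) ∂γ := by
          refine lintegral_mono fun g => (sum_law_pairError_le_risk σ est _ η).trans ?_
          by_cases hg : ‖θ₀ + α • g‖ < Δ
          · refine (risk_le_one σ est _ η).trans ?_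
            rw [Set.indicator_of_mem (by exact hg)]
            exact le_add_self
          · refine le_trans ?_ le_self_add
            exact le_iSup₂ (f := fun (x : EuclideanSpace ℝ (Fin p) × Labels n)
              (_ : x ∈ parameterSet n p Δ) => risk σ est x.1 x.2) (θ₀ + α • g, η)
              ⟨not_lt.1 hg, Set.mem_univ _⟩
      _ = R + q := by
          rw [lintegral_add_left measurable_const, lintegral_indicator_one hS, lintegral_const,
            measure_univ, mul_one]
  -- Reversing the `i`-th label complements the event, so the average over all labels of its
  -- probability is an average of sums of two testing errors.
  have hpair : ∀ i j, j ≠ i →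
      (Fintype.card (Labels n) : ENNReal) * ENNReal.ofReal T ≤ ∑ η, L η i j := by
    intro i j hij
    have hsymm : ∑ η, L (flip η i) i j = ∑ η, L η i j :=
      Equiv.sum_comp (Function.Involutive.toPerm (fun η : Labels n => flip η i)
        fun η => flip_flip η i) (fun η => L η i j)
    have h2 : (Fintype.card (Labels n) : ENNReal) * ENNReal.ofReal (2 * T) ≤
        ∑ η, (L η i j + L (flip η i) i j) := by
      rw [← nsmul_eq_mul, ← Finset.card_univ, ← Finset.sum_const]
      refine Finset.sum_le_sum fun η _ => ?_
      simp only [hL]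
      rw [pairError_flip est η hij]
      exact two_mul_gaussianTail_le_lintegral_law hσ α θ₀ η i hpos
        (measurableSet_pairError est η i j)
    rw [Finset.sum_add_distrib, hsymm, ← two_mul, ENNReal.ofReal_mul zero_le_two,
      mul_left_comm, ENNReal.ofReal_ofNat] at h2
    exact (ENNReal.mul_le_mul_iff_right two_ne_zero ENNReal.ofNat_ne_top).1 h2
  set N : ENNReal := (Fintype.card (Labels n) : ENNReal) with hN
  have hN0 : N ≠ 0 := by simp [hN]
  have hNtop : N ≠ ⊤ := by simp [hN]
  have hn0 : (n : ENNReal) ≠ 0 := by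
    have : n ≠ 0 := by omega
    exact_mod_cast this
  have hntop : (n : ENNReal) ≠ ⊤ := by simp
  have hlower : (n : ENNReal) * ((n : ENNReal) * (N * ENNReal.ofReal T)) ≤
      2 * ∑ i, ∑ j, ∑ η, L η i j := by
    calc (n : ENNReal) * ((n : ENNReal) * (N * ENNReal.ofReal T))
        ≤ (n : ENNReal) * ((2 * ((n - 1 : ℕ) : ENNReal)) * (N * ENNReal.ofReal T)) := by
          gcongr
          have : n ≤ 2 * (n - 1) := by omega
          exact_mod_cast this
      _ = 2 * ∑ i : Fin n, ∑ j ∈ Finset.univ.erase i, N * ENNReal.ofReal T := by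
          simp only [Finset.sum_const, Finset.card_erase_of_mem (Finset.mem_univ _),
            Finset.card_univ, Fintype.card_fin, nsmul_eq_mul]
          ring
      _ ≤ _ := by
          gcongr with i
          refine le_trans (Finset.sum_le_sum fun j hj => hpair i j (Finset.ne_of_mem_erase hj)) ?_
          exact Finset.sum_le_sum_of_subset (Finset.erase_subset _ _)
  have hsum : (n : ENNReal)⁻¹ * ((n : ENNReal)⁻¹ * ∑ i, ∑ j, ∑ η, L η i j) ≤ N * (R + q) := by
    have hswap : ∑ i, ∑ j, ∑ η, L η i j = ∑ η, ∑ i, ∑ j, L η i j := by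
      simp_rw [Finset.sum_comm (s := Finset.univ (α := Fin n)) (t := Finset.univ (α := Labels n))]
    rw [hswap, Finset.mul_sum, Finset.mul_sum, hN, ← nsmul_eq_mul, ← Finset.card_univ,
      ← Finset.sum_const]
    exact Finset.sum_le_sum fun η _ => hupper η
  have hfin : N * ENNReal.ofReal T ≤ N * (2 * (R + q)) := by
    calc N * ENNReal.ofReal T
        = (n : ENNReal)⁻¹ * ((n : ENNReal)⁻¹ *
            ((n : ENNReal) * ((n : ENNReal) * (N * ENNReal.ofReal T)))) := by
          rw [ENNReal.inv_mul_cancel_left hn0 hntop, ENNReal.inv_mul_cancel_left hn0 hntop]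
      _ ≤ (n : ENNReal)⁻¹ * ((n : ENNReal)⁻¹ * (2 * ∑ i, ∑ j, ∑ η, L η i j)) := by gcongr
      _ = 2 * ((n : ENNReal)⁻¹ * ((n : ENNReal)⁻¹ * ∑ i, ∑ j, ∑ η, L η i j)) := by ring
      _ ≤ 2 * (N * (R + q)) := by gcongr
      _ = _ := by ring
  exact (ENNReal.mul_le_mul_iff_right hN0 hNtop).1 hfin

/-- The Bayes lower bound for a prior `N(θ₀, α² I)` that charges the ball of radius `Δ` little
enough. -/
lemma quarter_gaussianTail_le_minimaxRisk (hn : 2 ≤ n) {σ : ℝ} (hσ : 0 < σ) (Δ α : ℝ)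
    (θ₀ : EuclideanSpace ℝ (Fin p)) {t : ℝ} (ht : 0 < t)
    (hsq : ‖θ₀‖ ^ 2 + (n - 1) * α ^ 4 / ((n - 1) * α ^ 2 + σ ^ 2) * p = (t * σ) ^ 2)
    (hq : stdGaussian (EuclideanSpace ℝ (Fin p)) {g | ‖θ₀ + α • g‖ < Δ} ≤
      ENNReal.ofReal (gaussianTail t / 4)) :
    ENNReal.ofReal (gaussianTail t / 4) ≤ minimaxRisk n p σ Δ := by
  refine le_iInf fun est => ?_
  have h := gaussianTail_le_two_mul_iSup_risk hn hσ Δ α θ₀ (by rw [hsq]; positivity) est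
  rw [hsq, Real.sqrt_sq (by positivity), mul_div_cancel_right₀ _ hσ.ne'] at h
  set R := ⨆ x ∈ parameterSet n p Δ, risk σ est x.1 x.2
  have hT := gaussianTail_nonneg t
  have h4 : ENNReal.ofReal (gaussianTail t) =
      2 * (ENNReal.ofReal (gaussianTail t / 4) + ENNReal.ofReal (gaussianTail t / 4)) := by
    rw [← ENNReal.ofReal_add (by positivity) (by positivity), ← ENNReal.ofReal_ofNat 2,
      ← ENNReal.ofReal_mul (by positivity)]
    congr 1
    ring
  have h5 := h.trans (mul_le_mul_right (add_le_add_right hq R) 2)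
  rw [h4, ENNReal.mul_le_mul_iff_right two_ne_zero ENNReal.ofNat_ne_top] at h5
  exact (ENNReal.add_le_add_iff_right ENNReal.ofReal_ne_top).1 h5

end Reduction

/-! ### Comparison with the signal-to-noise ratio -/

section Rate

variable {n p : ℕ}

/-- Lower bound obtained by letting the estimator know `θ`. -/
lemma quarter_gaussianTail_ratio_le_minimaxRisk (hn : 2 ≤ n) (hp : 1 ≤ p) {σ Δ : ℝ} (hσ : 0 < σ)
    (hΔ : 0 < Δ) : ENNReal.ofReal (gaussianTail (Δ / σ) / 4) ≤ minimaxRisk n p σ Δ := by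
  have : Nonempty (Fin p) := ⟨⟨0, hp⟩⟩
  obtain ⟨θ₀, hθ⟩ : ∃ θ : EuclideanSpace ℝ (Fin p), ‖θ‖ = Δ := exists_norm_eq _ hΔ.le
  refine quarter_gaussianTail_le_minimaxRisk hn hσ Δ 0 θ₀ (by positivity) ?_ ?_
  · rw [hθ]
    field_simp
    simp
  · simp [hθ]

/-- The mean square of the norm of the conditional mean of `θ`, when `θ` has the prior `N(0, a I)`
with `a = Δ² (1 + ε) / p`, is at most `(σ r_n (1 + ε))²`. -/
lemma div_le_mul_snr_sq {σ Δ ε : ℝ} (hn : 2 ≤ n) (hp : 1 ≤ p) (hσ : 0 < σ) (hΔ : 0 < Δ)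
    (hε : 0 ≤ ε) {a : ℝ} (ha : a = Δ ^ 2 * (1 + ε) / p) :
    (n - 1) * a ^ 2 / ((n - 1) * a + σ ^ 2) * p ≤ (snr n p σ Δ * (1 + ε) * σ) ^ 2 := by
  have hn' : (2 : ℝ) ≤ n := by exact_mod_cast hn
  have hp' : (0 : ℝ) < p := by exact_mod_cast hp
  have hm : (0 : ℝ) < n - 1 := by linarith
  have hsnr : (snr n p σ Δ * (1 + ε) * σ) ^ 2 =
      (Δ ^ 2 * (1 + ε)) ^ 2 / (Δ ^ 2 + p * σ ^ 2 / n) := by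
    rw [snr, mul_pow, mul_pow, div_pow, Real.sq_sqrt (by positivity)]
    field_simp
  rw [hsnr]
  have e : (n - 1) * a ^ 2 / ((n - 1) * a + σ ^ 2) * p =
      (Δ ^ 2 * (1 + ε)) ^ 2 / (Δ ^ 2 * (1 + ε) + p * σ ^ 2 / (n - 1)) := by
    rw [ha]
    field_simp
  rw [e]
  gcongr
  · nlinarith [mul_nonneg (sq_nonneg Δ) hε]
  · linarith

/-- Lower bound obtained from a centred Gaussian prior for `θ`, whose variance is inflated by
`1 + ε` so that the prior charges the ball of radius `Δ` very little. -/
lemma quarter_gaussianTail_snr_le_minimaxRisk (hn : 2 ≤ n) (hp : 1 ≤ p) {σ Δ ε : ℝ} (hσ : 0 < σ)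
    (hΔ : 0 < Δ) (h0 : 0 ≤ ε) (h1 : ε ≤ 1)
    (h : Real.exp (-(p * ε ^ 2 / 12)) ≤ gaussianTail (snr n p σ Δ * (1 + ε)) / 4) :
    ENNReal.ofReal (gaussianTail (snr n p σ Δ * (1 + ε)) / 4) ≤ minimaxRisk n p σ Δ := by
  have hn' : (2 : ℝ) ≤ n := by exact_mod_cast hn
  have hp' : (0 : ℝ) < p := by exact_mod_cast hp
  have hm : (0 : ℝ) < n - 1 := by linarith
  have hr : 0 ≤ snr n p σ Δ := by unfold snr; positivity
  set a := Δ ^ 2 * (1 + ε) / p with ha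
  have ha0 : 0 < a := by positivity
  have hα : √a ^ 2 = a := Real.sq_sqrt ha0.le
  have hα4 : √a ^ 4 = a ^ 2 := by linear_combination (√a ^ 2 + a) * hα
  set V := (n - 1) * a ^ 2 / ((n - 1) * a + σ ^ 2) * p with hV
  have hV0 : 0 < V := by positivity
  set t := √V / σ with ht
  have ht0 : 0 < t := by positivity
  have htle : t ≤ snr n p σ Δ * (1 + ε) := by
    rw [ht, div_le_iff₀ hσ]
    exact Real.sqrt_le_left (by positivity) |>.2 (div_le_mul_snr_sq hn hp hσ hΔ h0 ha)
  have hT := gaussianTail_antitone htle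
  refine (ENNReal.ofReal_le_ofReal (by linarith)).trans
    (quarter_gaussianTail_le_minimaxRisk hn hσ Δ (√a) 0 ht0 ?_ ?_)
  · rw [hα, hα4, ht, div_mul_cancel₀ _ hσ.ne', Real.sq_sqrt hV0.le]
    simp [hV]
  · have hsub : {g : EuclideanSpace ℝ (Fin p) | ‖0 + √a • g‖ < Δ} ⊆
        {g | (1 + ε) * ‖g‖ ^ 2 < p} := by
      intro g hg
      have hg' : ‖0 + √a • g‖ < Δ := hg
      rw [zero_add, norm_smul, Real.norm_of_nonneg (Real.sqrt_nonneg a)] at hg'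
      have h2 : a * ‖g‖ ^ 2 < Δ ^ 2 := by
        rw [← hα, ← mul_pow]
        gcongr
      show (1 + ε) * ‖g‖ ^ 2 < p
      rw [ha, div_mul_eq_mul_div, div_lt_iff₀ hp', mul_assoc] at h2
      exact lt_of_mul_lt_mul_left h2 (by positivity)
    refine (measure_mono hsub).trans ((stdGaussian_norm_sq_lt_le p h0 h1).trans
      (ENNReal.ofReal_le_ofReal ?_))
    linarith

/-- In low dimension, knowing `θ` does not change the signal-to-noise ratio by more than a factor
`1 + ε`. -/
lemma ratio_le_snr_mul {σ Δ ε : ℝ} (hn : 2 ≤ n) (hσ : 0 < σ) (hΔ : 0 < Δ) (hε : 0 ≤ ε)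
    (h : (p : ℝ) ≤ ε * n * (Δ / σ) ^ 2) : Δ / σ ≤ snr n p σ Δ * (1 + ε) := by
  have hn' : (0 : ℝ) < n := by
    have : 0 < n := by omega
    exact_mod_cast this
  set s := Δ / σ with hs
  have hs0 : 0 < s := by positivity
  rw [snr, ← div_pow, ← hs, div_mul_eq_mul_div, le_div_iff₀ (by positivity)]
  have h1 : (p : ℝ) / n ≤ ε * s ^ 2 := by
    rw [div_le_iff₀ hn']
    linarith
  have h2 : √(s ^ 2 + p / n) ≤ s * (1 + ε) :=
    Real.sqrt_le_left (by positivity) |>.2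
      (by nlinarith [mul_nonneg hε (sq_nonneg s), sq_nonneg (s * ε)])
  nlinarith

/-- In high dimension, the square of the signal-to-noise ratio is of smaller order than the
exponent `p ε²` of the Chernoff bound. -/
lemma snr_mul_sq_le {σ Δ ε : ℝ} (hn : 2 ≤ n) (hp : 1 ≤ p) (hσ : 0 < σ) (hΔ : 0 < Δ)
    (h0 : 0 < ε) (h1 : ε ≤ 1) (h : ε * n * (Δ / σ) ^ 2 ≤ p) :
    (snr n p σ Δ * (1 + ε)) ^ 2 ≤ 4 * p / (ε ^ 2 * n) := by
  have hn' : (0 : ℝ) < n := by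
    have : 0 < n := by omega
    exact_mod_cast this
  have hp' : (0 : ℝ) < p := by exact_mod_cast hp
  set s := Δ / σ with hs
  have hs0 : 0 < s := by positivity
  rw [snr, ← div_pow, ← hs, mul_pow, div_pow, Real.sq_sqrt (by positivity)]
  calc (s ^ 2) ^ 2 / (s ^ 2 + p / n) * (1 + ε) ^ 2
      ≤ (p / (ε * n)) ^ 2 / (p / n) * 2 ^ 2 := by
        have : s ^ 2 ≤ p / (ε * n) := by
          rw [le_div_iff₀ (by positivity)]
          linarith
        gcongr
        · nlinarith [sq_nonneg s]
        · linarith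
    _ = _ := by
        field_simp
        norm_num

end Rate

end GaussianMixture

open GaussianMixture in
theorem theorem2p2 :
    ∃ c : ℝ, 0 < c ∧ ∃ ε : ℕ → ℝ, Tendsto ε atTop (𝓝 0) ∧
      ∀ᶠ n : ℕ in atTop, ∀ p : ℕ, 1 ≤ p → ∀ σ Δ : ℝ, 0 < σ → 0 < Δ →
        ENNReal.ofReal
            (c * GaussianMixture.gaussianTail (GaussianMixture.snr n p σ Δ * (1 + ε n))) ≤
          GaussianMixture.minimaxRisk n p σ Δ := by
  set K : ℝ := (√(2 * Real.pi))⁻¹ * Real.exp (-1) with hK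
  have hK0 : 0 < K := by positivity
  have hT2 : 0 < gaussianTail 2 :=
    lt_of_lt_of_le (by positivity) (exp_neg_sq_le_gaussianTail (t := 2) (by norm_num))
  have hx : Tendsto (fun n : ℕ => (n : ℝ) ^ (1 / 8 : ℝ)) atTop atTop :=
    (tendsto_rpow_atTop (by norm_num)).comp tendsto_natCast_atTop_atTop
  refine ⟨gaussianTail 2 / 4, by positivity, fun n => ((n : ℝ) ^ (1 / 8 : ℝ))⁻¹,
    hx.inv_tendsto_atTop, ?_⟩
  filter_upwards [eventually_ge_atTop 2, hx.eventually_ge_atTop 4,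
    hx.eventually_ge_atTop (24 * Real.log (4 / K))] with n hn hx4 hxK p hp σ Δ hσ hΔ
  set x : ℝ := (n : ℝ) ^ (1 / 8 : ℝ) with hx_def
  have hx8 : (n : ℝ) = x ^ 8 := by
    rw [hx_def, ← Real.rpow_natCast, ← Real.rpow_mul (by positivity)]
    norm_num
  have hx0 : 0 < x := by linarith
  have hε0 : 0 < x⁻¹ := by positivity
  have hε1 : x⁻¹ ≤ 1 := inv_le_one_of_one_le₀ (by linarith)
  have hT0 := gaussianTail_nonneg (snr n p σ Δ * (1 + x⁻¹))
  have hT1 := gaussianTail_le_one (snr n p σ Δ * (1 + x⁻¹))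
  have hknown := quarter_gaussianTail_ratio_le_minimaxRisk hn hp hσ hΔ
  have hquarter : gaussianTail 2 / 4 * gaussianTail (snr n p σ Δ * (1 + x⁻¹)) ≤
      gaussianTail (snr n p σ Δ * (1 + x⁻¹)) / 4 := by
    have := mul_le_mul_of_nonneg_right (gaussianTail_le_one 2) hT0
    linarith
  -- For bounded `Δ / σ` a constant lower bound is enough.
  by_cases hs : Δ / σ ≤ 2
  · refine (ENNReal.ofReal_le_ofReal ?_).trans hknown
    have h2 := gaussianTail_antitone hs
    have := mul_le_mul_of_nonneg_left hT1 hT2.le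
    linarith
  by_cases hcase : (p : ℝ) ≤ x⁻¹ * n * (Δ / σ) ^ 2
  · refine (ENNReal.ofReal_le_ofReal ?_).trans hknown
    have := gaussianTail_antitone (ratio_le_snr_mul hn hσ hΔ hε0.le hcase)
    linarith
  refine (ENNReal.ofReal_le_ofReal hquarter).trans
    (quarter_gaussianTail_snr_le_minimaxRisk hn hp hσ hΔ hε0.le hε1 ?_)
  push Not at hs hcase
  have hr : 0 ≤ snr n p σ Δ := by unfold snr; positivity
  have hlow := exp_neg_sq_le_gaussianTail (t := snr n p σ Δ * (1 + x⁻¹)) (by positivity)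
  have hsq := snr_mul_sq_le hn hp hσ hΔ hε0 hε1 hcase.le
  suffices Real.exp (-(p * x⁻¹ ^ 2 / 12)) ≤
      K / 4 * Real.exp (-(snr n p σ Δ * (1 + x⁻¹)) ^ 2) by linarith
  have hK4 : K / 4 = Real.exp (-Real.log (4 / K)) := by
    rw [← Real.log_inv, Real.exp_log (by positivity), inv_div]
  rw [hK4, ← Real.exp_add, Real.exp_le_exp]
  -- The squared signal-to-noise ratio is at most `4 p x⁻⁶`, half of `p x⁻² / 12` or less, and the
  -- other half absorbs the constant, because `p ≥ x⁷`.
  have hp7 : x ^ 7 ≤ p := by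
    have h4 : 1 ≤ (Δ / σ) ^ 2 := by nlinarith
    have : x⁻¹ * n = x ^ 7 := by
      rw [hx8]
      field_simp
    rw [this] at hcase
    nlinarith [pow_pos hx0 7]
  have hb : 4 * (p : ℝ) / (x⁻¹ ^ 2 * n) ≤ p * x⁻¹ ^ 2 / 24 := by
    have e1 : 4 * (p : ℝ) / (x⁻¹ ^ 2 * n) = p * x⁻¹ ^ 2 * (4 / x ^ 4) := by
      rw [hx8]
      field_simp
    have e2 : 4 / x ^ 4 ≤ 1 / 24 := by
      rw [div_le_div_iff₀ (by positivity) (by norm_num)]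
      nlinarith [pow_le_pow_left₀ (by norm_num) hx4 4]
    rw [e1, div_eq_mul_one_div _ (24 : ℝ)]
    gcongr
  have hc : Real.log (4 / K) ≤ p * x⁻¹ ^ 2 / 24 := by
    have e1 : x ^ 7 * x⁻¹ ^ 2 = x ^ 5 := by field_simp
    have e2 : x ≤ x ^ 5 := le_self_pow₀ (by linarith) (by norm_num)
    have e3 : x ^ 7 * x⁻¹ ^ 2 ≤ p * x⁻¹ ^ 2 := by gcongr
    linarith
  linarith
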